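/- **Conventions.** Let $G$ be a compact (Hausdorff), second countable group, let $\sigma$ be the action of $G$ on $C(G)$ by left translation, $\sigma_s(f)(t)=f(s^{-1}t)$, and let $A$ be a separable C*-algebra. An action $\alpha$ of $G$ on $A$ is a homomorphism $\alpha:G\to\mathrm{Aut}(A)$ such that $g\mapsto\alpha_g(a)$ is norm continuous for every $a\in A$. Let $A_\infty=\ell^\infty(\mathbb N,A)/c_0(\mathbb N,A)$, with quotient map $\eta_A$, and regard $A$ as a subalgebra of $A_\infty$ via constant sequences. Let $$F(A)=(A_\infty\cap A')/\mathrm{Ann}(A,A_\infty),$$ with quotient map $\kappa_A:A_\infty\cap A'\to F(A)$, where $\mathrm{Ann}(A,A_\infty)=\{x\in A_\infty\cap A' : xa=ax=0 \text{ for all } a\in A\}$; this algebra is unital. The action $\alpha$ induces coordinatewise an action $\alpha^\infty$ of $G$ by automorphisms of $\ell^\infty(\mathbb N,A)$, and an action $F(\alpha)$ by automorphisms of $F(A)$. Let $\ell^\infty_\alpha(\mathbb N,A)$ be the set of all $a\in\ell^\infty(\mathbb N,A)$ such that $g\mapsto\alpha^\infty_g(a)$ is norm continuous, let $A_{\infty,\alpha}=\eta_A(\ell^\infty_\alpha(\mathbb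 N,A))$ and $F_\alpha(A)=\kappa_A(A_{\infty,\alpha}\cap A')$. Elements $a,b$ of a C*-algebra are orthogonal, written $a\perp b$, if $ab=ba=a^*b=b^*a=0$; a contractive completely positive (c.c.p.) map $\varphi$ has order zero if $a\perp b$ implies $\varphi(a)\perp\varphi(b)$. The Rokhlin dimension $\dim_{Rok}(\alpha)$ is the least integer $d\ge 0$ for which there are equivariant c.c.p. order zero maps $\varphi_0,\dots,\varphi_d:(C(G),\sigma)\to(F_\alpha(A),F(\alpha))$ with $\sum_{j=0}^d\varphi_j(1)=1$, and $\dim_{Rok}(\alpha)=+\infty$ if there is no such $d$. **Statement.** Let $G$ be a compact, second countable group, let $A$ be a separable C*-algebra, and let $S=S^*\subset A$ be a countable set that generates $A$ as a (not necessarily unital) C*-algebra. Let $\alpha$ be an action of $G$ on $A$ and let $d\ge 0$ be an integer. Then $\dim_{Rok}(\alpha)\le d$ if and only if for all finite sets $F\subset S$ and $K\subset C(G)$ and every $\varepsilon>0$ there are c.c.p. maps $\psi_0,\dots,\psi_d:C(G)\to A$ such that 1. $\|\psi_j(f_1)\psi_j(f_2)\|<\varepsilon$ for all $f_1,f_2\in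 K$ with $f_1\perp f_2$ and all $0\le j\le d$; 2. $\|\psi_j(f)a-a\psi_j(f)\|<\varepsilon$ for all $a\in F$, $f\in K$ and $0\le j\le d$; 3. $\|\alpha_s(\psi_j(f))-\psi_j(\sigma_s(f))\|<\varepsilon$ for all $f\in K$, $s\in G$ and $0\le j\le d$; 4. $\left\|\sum_{j=0}^d\psi_j(1_{C(G)})\,a-a\right\|<\varepsilon$ for all $a\in F$. -/

import Mathlib

open Filter Topology
open scoped ENNReal ComplexOrder CStarAlgebra

noncomputable section

/-! ## Quotients of C⋆-algebras by closed two-sided ideals -/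

/-- A closed two-sided (self-adjoint) ideal of a C⋆-algebra. -/
structure CStarIdeal (B : Type*) [NonUnitalCStarAlgebra B] extends Submodule ℂ B where
  mul_mem_left' : ∀ (b : B) {x : B}, x ∈ carrier → b * x ∈ carrier
  mul_mem_right' : ∀ (b : B) {x : B}, x ∈ carrier → x * b ∈ carrier
  star_mem' : ∀ {x : B}, x ∈ carrier → star x ∈ carrier
  isClosed' : IsClosed carrier

namespace CStarIdeal

section Quotient

variable {B : Type*} [NonUnitalCStarAlgebra B] (I : CStarIdeal B)

/-- The quotient `B / I`, with the quotient norm. -/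
def Quot : Type _ := B ⧸ I.toSubmodule

instance instClosed : IsClosed (I.toSubmodule : Set B) := I.isClosed'

instance : NormedAddCommGroup I.Quot :=
  inferInstanceAs (NormedAddCommGroup (B ⧸ I.toSubmodule))

instance : NormedSpace ℂ I.Quot :=
  inferInstanceAs (NormedSpace ℂ (B ⧸ I.toSubmodule))

instance : CompleteSpace I.Quot :=
  inferInstanceAs (CompleteSpace (B ⧸ I.toSubmodule))

/-- The quotient map as a linear map. -/
def mkₗ : B →ₗ[ℂ] I.Quot := I.toSubmodule.mkQ

theorem mkₗ_surjective : Function.Surjective I.mkₗ := I.toSubmodule.mkQ_surjective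

theorem mkₗ_eq_iff {a b : B} : I.mkₗ a = I.mkₗ b ↔ a - b ∈ I.toSubmodule :=
  Submodule.Quotient.eq I.toSubmodule

theorem mkₗ_eq_zero_iff {a : B} : I.mkₗ a = 0 ↔ a ∈ I.toSubmodule :=
  Submodule.Quotient.mk_eq_zero I.toSubmodule

theorem norm_mkₗ_le (a : B) : ‖I.mkₗ a‖ ≤ ‖a‖ := Submodule.Quotient.norm_mk_le I.toSubmodule a

theorem exists_norm_lt (x : I.Quot) {ε : ℝ} (hε : 0 < ε) : ∃ a : B, I.mkₗ a = x ∧ ‖a‖ < ‖x‖ + ε :=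
  Submodule.Quotient.norm_mk_lt (S := I.toSubmodule) x hε

instance : Mul I.Quot where
  mul := Quotient.map₂ (· * ·) (by
    intro a a' ha b b' hb
    have ha' : a - a' ∈ I.toSubmodule := (Submodule.quotientRel_def _).1 ha
    have hb' : b - b' ∈ I.toSubmodule := (Submodule.quotientRel_def _).1 hb
    refine (Submodule.quotientRel_def _).2 ?_
    have h : a * b - a' * b' = (a - a') * b + a' * (b - b') := by
      simp only [sub_mul, mul_sub]; abel
    rw [h]
    exact I.toSubmodule.add_mem (I.mul_mem_right' _ ha') (I.mul_mem_left' _ hb'))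

theorem mkₗ_mul (a b : B) : I.mkₗ (a * b) = I.mkₗ a * I.mkₗ b := rfl

instance : Star I.Quot where
  star := Quotient.map star (by
    intro a a' ha
    have ha' : a - a' ∈ I.toSubmodule := (Submodule.quotientRel_def _).1 ha
    refine (Submodule.quotientRel_def _).2 ?_
    rw [← star_sub]
    exact I.star_mem' ha')

theorem mkₗ_star (a : B) : I.mkₗ (star a) = star (I.mkₗ a) := rfl

instance : NonUnitalRing I.Quot where
  left_distrib x y z := by
    obtain ⟨a, rfl⟩ := I.mkₗ_surjective x
    obtain ⟨b, rfl⟩ := I.mkₗ_surjective y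
    obtain ⟨c, rfl⟩ := I.mkₗ_surjective z
    simp only [← map_add, ← mkₗ_mul, mul_add]
  right_distrib x y z := by
    obtain ⟨a, rfl⟩ := I.mkₗ_surjective x
    obtain ⟨b, rfl⟩ := I.mkₗ_surjective y
    obtain ⟨c, rfl⟩ := I.mkₗ_surjective z
    simp only [← map_add, ← mkₗ_mul, add_mul]
  zero_mul x := by
    obtain ⟨a, rfl⟩ := I.mkₗ_surjective x
    rw [← map_zero I.mkₗ, ← mkₗ_mul, zero_mul]
  mul_zero x := by
    obtain ⟨a, rfl⟩ := I.mkₗ_surjective x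
    rw [← map_zero I.mkₗ, ← mkₗ_mul, mul_zero]
  mul_assoc x y z := by
    obtain ⟨a, rfl⟩ := I.mkₗ_surjective x
    obtain ⟨b, rfl⟩ := I.mkₗ_surjective y
    obtain ⟨c, rfl⟩ := I.mkₗ_surjective z
    simp only [← mkₗ_mul, mul_assoc]

instance : StarRing I.Quot where
  star_involutive x := by
    obtain ⟨a, rfl⟩ := I.mkₗ_surjective x
    simp only [← mkₗ_star, star_star]
  star_mul x y := by
    obtain ⟨a, rfl⟩ := I.mkₗ_surjective x
    obtain ⟨b, rfl⟩ := I.mkₗ_surjective y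
    simp only [← mkₗ_mul, ← mkₗ_star, star_mul]
  star_add x y := by
    obtain ⟨a, rfl⟩ := I.mkₗ_surjective x
    obtain ⟨b, rfl⟩ := I.mkₗ_surjective y
    simp only [← map_add, ← mkₗ_star, star_add]

instance : IsScalarTower ℂ I.Quot I.Quot where
  smul_assoc c x y := by
    obtain ⟨a, rfl⟩ := I.mkₗ_surjective x
    obtain ⟨b, rfl⟩ := I.mkₗ_surjective y
    simp only [smul_eq_mul, ← map_smul, ← mkₗ_mul, smul_mul_assoc]

instance : SMulCommClass ℂ I.Quot I.Quot where
  smul_comm c x y := by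
    obtain ⟨a, rfl⟩ := I.mkₗ_surjective x
    obtain ⟨b, rfl⟩ := I.mkₗ_surjective y
    simp only [smul_eq_mul, ← map_smul, ← mkₗ_mul, mul_smul_comm]

instance : StarModule ℂ I.Quot where
  star_smul c x := by
    obtain ⟨a, rfl⟩ := I.mkₗ_surjective x
    simp only [← map_smul, ← mkₗ_star, star_smul]

theorem norm_mul_le' (x y : I.Quot) : ‖x * y‖ ≤ ‖x‖ * ‖y‖ := by
  have key : ∀ ε : ℝ, 0 < ε → ‖x * y‖ ≤ (‖x‖ + ε) * (‖y‖ + ε) := by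
    intro ε hε
    obtain ⟨a, rfl, ha⟩ := I.exists_norm_lt x hε
    obtain ⟨b, rfl, hb⟩ := I.exists_norm_lt y hε
    calc ‖I.mkₗ a * I.mkₗ b‖ = ‖I.mkₗ (a * b)‖ := by rw [mkₗ_mul]
      _ ≤ ‖a * b‖ := I.norm_mkₗ_le _
      _ ≤ ‖a‖ * ‖b‖ := norm_mul_le a b
      _ ≤ _ := by gcongr
  have hlim : Tendsto (fun ε : ℝ => (‖x‖ + ε) * (‖y‖ + ε)) (𝓝[>] 0) (𝓝 (‖x‖ * ‖y‖)) := by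
    have : Continuous (fun ε : ℝ => (‖x‖ + ε) * (‖y‖ + ε)) := by fun_prop
    simpa using (this.tendsto 0).mono_left nhdsWithin_le_nhds
  exact ge_of_tendsto hlim (eventually_nhdsWithin_of_forall key)

instance : NonUnitalNormedRing I.Quot where
  dist_eq := NormedAddCommGroup.dist_eq
  norm_mul_le := I.norm_mul_le'

/-- The ideal as a closed ⋆-subalgebra. -/
def toSubalg : NonUnitalStarSubalgebra ℂ B where
  carrier := I.carrier
  add_mem' := I.add_mem'
  zero_mem' := I.zero_mem'
  smul_mem' := I.smul_mem'
  mul_mem' := fun {a _} _ hb => I.mul_mem_left' a hb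
  star_mem' := I.star_mem'

instance : IsClosed (I.toSubalg : Set B) := I.isClosed'

theorem norm_one_sub_conj_le {C : Type*} [NonUnitalCStarAlgebra C] (e : Unitization ℂ C)
    (he : ‖1 - e‖ ≤ 1) (he' : ‖1 - star e‖ ≤ 1) (y : Unitization ℂ C) :
    ‖(1 - star e) * y * (1 - e)‖ ≤ ‖y‖ := by
  calc ‖(1 - star e) * y * (1 - e)‖ ≤ ‖1 - star e‖ * ‖y‖ * ‖1 - e‖ := norm_mul₃_le
    _ ≤ 1 * ‖y‖ * 1 := by gcongr
    _ = ‖y‖ := by ring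

theorem norm_mkₗ_sq_le (b : B) : ‖I.mkₗ b‖ * ‖I.mkₗ b‖ ≤ ‖star (I.mkₗ b) * I.mkₗ b‖ := by
  refine le_of_forall_pos_le_add fun ε hε => ?_
  obtain ⟨y, hy, hyn⟩ := I.exists_norm_lt (star (I.mkₗ b) * I.mkₗ b) (half_pos hε)
  rw [← mkₗ_star, ← mkₗ_mul, mkₗ_eq_iff] at hy
  let S := I.toSubalg
  let _ : PartialOrder S := CStarAlgebra.spectralOrder S
  have _ : StarOrderedRing S := CStarAlgebra.spectralOrderedRing S
  let i : S := ⟨star b * b - y, by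
    have := I.toSubmodule.neg_mem hy
    rwa [neg_sub] at this⟩
  have hau := CStarAlgebra.increasingApproximateUnit S
  have hlim : Tendsto (fun e : S => 2 * ‖i - i * e‖) (CStarAlgebra.approximateUnit S) (𝓝 0) := by
    have h1 : Tendsto (fun e : S => i - i * e) (CStarAlgebra.approximateUnit S) (𝓝 (i - i)) :=
      tendsto_const_nhds.sub (hau.tendsto_mul_left i)
    simpa using h1.norm.const_mul 2
  have hev := hlim.eventually (gt_mem_nhds (half_pos hε))
  obtain ⟨e, he1, he2, he3⟩ := (hev.and (hau.eventually_nonneg.and hau.eventually_norm)).exists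
  have hsa : star e = e := (IsSelfAdjoint.of_nonneg he2).star_eq
  let J : S →⋆ₙₐ[ℂ] Unitization ℂ B :=
    (Unitization.inrNonUnitalStarAlgHom ℂ B).comp (NonUnitalStarSubalgebraClass.subtype S)
  have hJ : ∀ s : S, J s = ((s : B) : Unitization ℂ B) := fun s => rfl
  have hE0 : 0 ≤ J e := map_nonneg J he2
  have hE1 : ‖J e‖ ≤ 1 := by rw [hJ, Unitization.norm_inr]; exact he3
  have hEI : J e ∈ Set.Icc 0 1 := CStarAlgebra.mem_Icc_iff_norm_le_one.2 ⟨hE0, hE1⟩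
  have hE2 : ‖1 - J e‖ ≤ 1 :=
    (CStarAlgebra.mem_Icc_iff_norm_le_one.1 (Set.sub_mem_Icc_zero_iff_right.2 hEI)).2
  have hEs : star (J e) = J e := by rw [← map_star, hsa]
  have hE2' : ‖1 - star (J e)‖ ≤ 1 := by rw [hEs]; exact hE2
  have hmk : I.mkₗ b = I.mkₗ (b - b * (e : B)) := by
    rw [mkₗ_eq_iff, sub_sub_cancel]
    exact I.mul_mem_left' b e.2
  have hdec : ((star (b - b * (e : B)) * (b - b * (e : B)) : B) : Unitization ℂ B)
      = (1 - star (J e)) * (y : Unitization ℂ B) * (1 - J e)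
        + (1 - star (J e)) * J (i - i * e) := by
    have hi : J i = ((star b * b : B) : Unitization ℂ B) - (y : Unitization ℂ B) := by
      rw [hJ]; simp [i, Unitization.inr_sub]
    have h1 : ((b - b * (e : B) : B) : Unitization ℂ B) = (b : Unitization ℂ B) * (1 - J e) := by
      rw [hJ, Unitization.inr_sub, Unitization.inr_mul, mul_sub, mul_one]
    rw [Unitization.inr_mul, Unitization.inr_star, h1, map_sub, map_mul, hi, Unitization.inr_mul,
      Unitization.inr_star, star_mul, star_sub, star_one]
    noncomm_ring
  have hn : ‖b - b * (e : B)‖ * ‖b - b * (e : B)‖ ≤ ‖y‖ + 2 * ‖i - i * e‖ := by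
    rw [← CStarRing.norm_star_mul_self, ← Unitization.norm_inr (𝕜 := ℂ), hdec]
    refine (norm_add_le _ _).trans (add_le_add ?_ ?_)
    · refine (norm_one_sub_conj_le (J e) hE2 hE2' _).trans_eq ?_
      rw [Unitization.norm_inr]
    · refine (norm_mul_le _ _).trans ?_
      have h3 : ‖J (i - i * e)‖ = ‖i - i * e‖ := by rw [hJ, Unitization.norm_inr]; rfl
      rw [h3]
      have := norm_nonneg (i - i * e)
      nlinarith
  have hq : ‖I.mkₗ b‖ ≤ ‖b - b * (e : B)‖ := by rw [hmk]; exact I.norm_mkₗ_le _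
  have := mul_le_mul hq hq (norm_nonneg _) (norm_nonneg _)
  rw [← mkₗ_star, ← mkₗ_mul] at hyn ⊢
  linarith

instance : CStarRing I.Quot where
  norm_mul_self_le x := by
    obtain ⟨b, rfl⟩ := I.mkₗ_surjective x
    exact I.norm_mkₗ_sq_le b

/-- The quotient of a C⋆-algebra by a closed two-sided ideal is a C⋆-algebra. -/
instance : NonUnitalCStarAlgebra I.Quot where

/-- The quotient carries its canonical order, whose positive elements are the `star x * x`. -/
instance : PartialOrder I.Quot := CStarAlgebra.spectralOrder I.Quot

instance : StarOrderedRing I.Quot := CStarAlgebra.spectralOrderedRing I.Quot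

/-- The quotient map as a ⋆-homomorphism. -/
def proj : B →⋆ₙₐ[ℂ] I.Quot where
  toFun := I.mkₗ
  map_smul' := I.mkₗ.map_smul
  map_zero' := I.mkₗ.map_zero
  map_add' := I.mkₗ.map_add
  map_mul' := I.mkₗ_mul
  map_star' := I.mkₗ_star

/-- A ⋆-homomorphism `f : B → C` with `f(I) ⊆ J` induces a ⋆-homomorphism `B / I → C / J`. -/
def map {C : Type*} [NonUnitalCStarAlgebra C] (J : CStarIdeal C) (f : B →⋆ₙₐ[ℂ] C)
    (h : ∀ x ∈ I.toSubmodule, f x ∈ J.toSubmodule) : I.Quot →⋆ₙₐ[ℂ] J.Quot where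
  toFun := I.toSubmodule.mapQ J.toSubmodule (f : B →ₗ[ℂ] C) h
  map_smul' := map_smul (I.toSubmodule.mapQ J.toSubmodule (f : B →ₗ[ℂ] C) h)
  map_zero' := map_zero (I.toSubmodule.mapQ J.toSubmodule (f : B →ₗ[ℂ] C) h)
  map_add' := map_add (I.toSubmodule.mapQ J.toSubmodule (f : B →ₗ[ℂ] C) h)
  map_mul' x y := by
    obtain ⟨a, rfl⟩ := I.mkₗ_surjective x
    obtain ⟨b, rfl⟩ := I.mkₗ_surjective y
    change J.mkₗ (f (a * b)) = J.mkₗ (f a) * J.mkₗ (f b)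
    rw [map_mul, mkₗ_mul]
  map_star' x := by
    obtain ⟨a, rfl⟩ := I.mkₗ_surjective x
    change J.mkₗ (f (star a)) = star (J.mkₗ (f a))
    rw [map_star, mkₗ_star]

theorem map_proj {C : Type*} [NonUnitalCStarAlgebra C] (J : CStarIdeal C) (f : B →⋆ₙₐ[ℂ] C)
    (h : ∀ x ∈ I.toSubmodule, f x ∈ J.toSubmodule) (b : B) :
    I.map J f h (I.proj b) = J.proj (f b) := rfl

end Quotient

end CStarIdeal

/-! ## The sequence algebra and the central sequence algebra -/

section Sequence

variable (A : Type*) [NonUnitalCStarAlgebra A]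

/-- `ℓ^∞(ℕ, A)`. -/
abbrev BddSeq : Type _ := lp (fun _ : ℕ => A) ∞

/-- The ideal `c₀(ℕ, A)` of `ℓ^∞(ℕ, A)`. -/
def c0Ideal : CStarIdeal (BddSeq A) where
  carrier := {a | Tendsto (fun n => a n) atTop (𝓝 0)}
  add_mem' {a b} ha hb := by
    have := Tendsto.add (f := fun n => a n) (g := fun n => b n) ha hb
    simpa using this
  zero_mem' := by simp
  smul_mem' c a ha := by
    have := Tendsto.const_smul (f := fun n => a n) ha c
    simpa using this
  mul_mem_left' b a ha := by
    refine squeeze_zero_norm (a := fun n => ‖b‖ * ‖a n‖) (fun n => ?_) ?_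
    · rw [lp.infty_coeFn_mul]
      exact (norm_mul_le _ _).trans
        (mul_le_mul_of_nonneg_right (lp.norm_apply_le_norm ENNReal.top_ne_zero b n) (norm_nonneg _))
    · have := (Tendsto.norm (f := fun n => a n) ha).const_mul ‖b‖
      simpa using this
  mul_mem_right' b a ha := by
    refine squeeze_zero_norm (a := fun n => ‖a n‖ * ‖b‖) (fun n => ?_) ?_
    · rw [lp.infty_coeFn_mul]
      exact (norm_mul_le _ _).trans
        (mul_le_mul_of_nonneg_left (lp.norm_apply_le_norm ENNReal.top_ne_zero b n) (norm_nonneg _))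
    · have := (Tendsto.norm (f := fun n => a n) ha).mul_const ‖b‖
      simpa using this
  star_mem' {a} ha := by
    have := Tendsto.star (f := fun n => a n) ha
    simpa using this
  isClosed' := by
    refine isClosed_of_closure_subset fun a ha => ?_
    refine Metric.tendsto_atTop.2 fun ε hε => ?_
    obtain ⟨b, hb, hab⟩ := Metric.mem_closure_iff.1 ha (ε / 2) (half_pos hε)
    obtain ⟨N, hN⟩ := Metric.tendsto_atTop.1 hb (ε / 2) (half_pos hε)
    refine ⟨N, fun n hn => ?_⟩
    have h1 : ‖a n - b n‖ ≤ ‖a - b‖ := lp.norm_apply_le_norm ENNReal.top_ne_zero (a - b) n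
    have h2 := hN n hn
    rw [dist_eq_norm] at hab
    rw [dist_zero_right] at h2 ⊢
    have h3 : ‖a n‖ ≤ ‖a n - b n‖ + ‖b n‖ := by
      simpa using norm_add_le (a n - b n) (b n)
    linarith

/-- `A_∞ = ℓ^∞(ℕ, A) / c₀(ℕ, A)`. -/
abbrev SeqAlg : Type _ := (c0Ideal A).Quot

/-- The quotient map `η_A : ℓ^∞(ℕ, A) → A_∞`. -/
def etaSeq : BddSeq A →⋆ₙₐ[ℂ] SeqAlg A := (c0Ideal A).proj

/-- The embedding of `A` in `ℓ^∞(ℕ, A)` as constant sequences. -/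
def constSeq : A →⋆ₙₐ[ℂ] BddSeq A where
  toFun a := ⟨fun _ => a, memℓp_infty ⟨‖a‖, by rintro _ ⟨n, rfl⟩; exact le_rfl⟩⟩
  map_smul' _ _ := rfl
  map_zero' := rfl
  map_add' _ _ := rfl
  map_mul' _ _ := rfl
  map_star' _ := rfl

/-- The embedding of `A` in `A_∞`. -/
def seqIncl : A →⋆ₙₐ[ℂ] SeqAlg A := (etaSeq A).comp (constSeq A)

/-- The relative commutant `A_∞ ∩ A'`. -/
def relCommutant : NonUnitalStarSubalgebra ℂ (SeqAlg A) :=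
  NonUnitalStarSubalgebra.centralizer ℂ (Set.range (seqIncl A))

theorem mem_relCommutant {x : SeqAlg A} :
    x ∈ relCommutant A ↔ ∀ a : A, seqIncl A a * x = x * seqIncl A a := by
  rw [relCommutant, NonUnitalStarSubalgebra.mem_centralizer_iff]
  constructor
  · intro h a
    exact (h _ ⟨a, rfl⟩).1
  · rintro h _ ⟨a, rfl⟩
    refine ⟨h a, ?_⟩
    rw [← map_star]
    exact h (star a)

instance relCommutant_isClosed : IsClosed (relCommutant A : Set (SeqAlg A)) := by
  have : (relCommutant A : Set (SeqAlg A))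
      = ⋂ a : A, {x | seqIncl A a * x = x * seqIncl A a} := by
    ext x
    simp only [SetLike.mem_coe, mem_relCommutant, Set.mem_iInter, Set.mem_ofPred_eq]
  rw [this]
  exact isClosed_iInter fun a =>
    isClosed_eq (by fun_prop) (by fun_prop)

/-- The annihilator `Ann(A, A_∞)`, an ideal of `A_∞ ∩ A'`. -/
def annIdeal : CStarIdeal (relCommutant A) where
  carrier := {x | ∀ a : A, seqIncl A a * (x : SeqAlg A) = 0 ∧ (x : SeqAlg A) * seqIncl A a = 0}
  add_mem' {x y} hx hy a := by
    simp [mul_add, add_mul, hx a, hy a]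
  zero_mem' a := by simp
  smul_mem' c x hx a := by
    simp [mul_smul_comm, smul_mul_assoc, hx a]
  mul_mem_left' y x hx a := by
    have hy := (mem_relCommutant A).1 y.2 a
    constructor
    · rw [MulMemClass.coe_mul, ← mul_assoc, hy, mul_assoc, (hx a).1, mul_zero]
    · rw [MulMemClass.coe_mul, mul_assoc, (hx a).2, mul_zero]
  mul_mem_right' y x hx a := by
    have hy := (mem_relCommutant A).1 y.2 a
    constructor
    · rw [MulMemClass.coe_mul, ← mul_assoc, (hx a).1, zero_mul]
    · rw [MulMemClass.coe_mul, mul_assoc, ← hy, ← mul_assoc, (hx a).2, zero_mul]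
  star_mem' {x} hx a := by
    have h := hx (star a)
    rw [map_star] at h
    constructor
    · have := congrArg star h.2
      simpa using this
    · have := congrArg star h.1
      simpa using this
  isClosed' := by
    have : {x : relCommutant A | ∀ a : A,
        seqIncl A a * (x : SeqAlg A) = 0 ∧ (x : SeqAlg A) * seqIncl A a = 0}
        = ⋂ a : A, ({x : relCommutant A | seqIncl A a * (x : SeqAlg A) = 0} ∩
            {x : relCommutant A | (x : SeqAlg A) * seqIncl A a = 0}) := by
      ext x
      simp
    rw [this]
    exact isClosed_iInter fun a =>
      (isClosed_eq (by fun_prop) (by fun_prop)).inter (isClosed_eq (by fun_prop) (by fun_prop))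

/-- The central sequence algebra `F(A) = (A_∞ ∩ A') / Ann(A, A_∞)`. -/
abbrev CentralSeqAlg : Type _ := (annIdeal A).Quot

/-- The quotient map `κ_A : A_∞ ∩ A' → F(A)`. -/
def kappaSeq : relCommutant A →⋆ₙₐ[ℂ] CentralSeqAlg A := (annIdeal A).proj

variable {A}

/-! ## Induced actions -/

/-- The coordinatewise ⋆-homomorphism of `ℓ^∞(ℕ, A)` induced by an automorphism of `A`. -/
def bddSeqMap (θ : A ≃⋆ₐ[ℂ] A) : BddSeq A →⋆ₙₐ[ℂ] BddSeq A where
  toFun a := ⟨fun n => θ (a n), memℓp_infty ⟨‖a‖, by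
    rintro _ ⟨n, rfl⟩
    exact (NonUnitalStarAlgHom.norm_apply_le θ (a n)).trans
      (lp.norm_apply_le_norm ENNReal.top_ne_zero a n)⟩⟩
  map_smul' c a := by ext n; exact map_smul θ c (a n)
  map_zero' := by ext n; exact map_zero θ
  map_add' a b := by ext n; exact map_add θ (a n) (b n)
  map_mul' a b := by ext n; exact map_mul θ (a n) (b n)
  map_star' a := by ext n; exact map_star θ (a n)

theorem bddSeqMap_c0 (θ : A ≃⋆ₐ[ℂ] A) :
    ∀ a ∈ (c0Ideal A).toSubmodule, bddSeqMap θ a ∈ (c0Ideal A).toSubmodule := by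
  intro a ha
  refine squeeze_zero_norm (a := fun n => ‖a n‖)
    (fun n => NonUnitalStarAlgHom.norm_apply_le θ (a n)) ?_
  simpa using Tendsto.norm (f := fun n => a n) ha

/-- The ⋆-homomorphism of `A_∞` induced by an automorphism of `A`. -/
def seqAlgMap (θ : A ≃⋆ₐ[ℂ] A) : SeqAlg A →⋆ₙₐ[ℂ] SeqAlg A :=
  (c0Ideal A).map (c0Ideal A) (bddSeqMap θ) (bddSeqMap_c0 θ)

theorem seqAlgMap_seqIncl (θ : A ≃⋆ₐ[ℂ] A) (a : A) :
    seqAlgMap θ (seqIncl A a) = seqIncl A (θ a) := rfl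

theorem seqAlgMap_mem (θ : A ≃⋆ₐ[ℂ] A) {x : SeqAlg A} (hx : x ∈ relCommutant A) :
    seqAlgMap θ x ∈ relCommutant A := by
  rw [mem_relCommutant] at hx ⊢
  intro a
  have h := congrArg (seqAlgMap θ) (hx (θ.symm a))
  rwa [map_mul, map_mul, seqAlgMap_seqIncl, StarAlgEquiv.apply_symm_apply] at h

/-- The ⋆-homomorphism of `A_∞ ∩ A'` induced by an automorphism of `A`. -/
def relCommutantMap (θ : A ≃⋆ₐ[ℂ] A) : relCommutant A →⋆ₙₐ[ℂ] relCommutant A :=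
  NonUnitalStarAlgHom.codRestrict
    ((seqAlgMap θ).comp (NonUnitalStarSubalgebraClass.subtype (relCommutant A)))
    (relCommutant A) (fun x => seqAlgMap_mem θ x.2)

theorem relCommutantMap_ann (θ : A ≃⋆ₐ[ℂ] A) :
    ∀ x ∈ (annIdeal A).toSubmodule, relCommutantMap θ x ∈ (annIdeal A).toSubmodule := by
  intro x hx a
  have h := hx (θ.symm a)
  have h1 := congrArg (seqAlgMap θ) h.1
  have h2 := congrArg (seqAlgMap θ) h.2
  rw [map_mul, map_zero, seqAlgMap_seqIncl, StarAlgEquiv.apply_symm_apply] at h1 h2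
  exact ⟨h1, h2⟩

/-- The ⋆-homomorphism of `F(A)` induced by an automorphism of `A`; for an action `α`, the
action `F(α)` is `g ↦ centralSeqMap (α g)`. -/
def centralSeqMap (θ : A ≃⋆ₐ[ℂ] A) : CentralSeqAlg A →⋆ₙₐ[ℂ] CentralSeqAlg A :=
  (annIdeal A).map (annIdeal A) (relCommutantMap θ) (relCommutantMap_ann θ)

end Sequence

section Continuous

variable {G A : Type*} [Group G] [TopologicalSpace G] [NonUnitalCStarAlgebra A]

/-- `ℓ^∞_α(ℕ, A)`: the bounded sequences on which the induced action is norm continuous. -/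
def bddSeqCont (α : G →* (A ≃⋆ₐ[ℂ] A)) : NonUnitalStarSubalgebra ℂ (BddSeq A) where
  carrier := {a | Continuous fun g => bddSeqMap (α g) a}
  add_mem' {a b} ha hb := by
    simp only [Set.mem_ofPred_eq, map_add] at ha hb ⊢
    exact ha.add hb
  zero_mem' := by
    simp only [Set.mem_ofPred_eq, map_zero]
    exact continuous_const
  smul_mem' c a ha := by
    simp only [Set.mem_ofPred_eq, map_smul] at ha ⊢
    exact ha.const_smul c
  mul_mem' {a b} ha hb := by
    simp only [Set.mem_ofPred_eq, map_mul] at ha hb ⊢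
    exact ha.mul hb
  star_mem' {a} ha := by
    have h : Continuous fun g => star (bddSeqMap (α g) a) := Continuous.star ha
    change Continuous fun g => bddSeqMap (α g) (star a)
    simpa only [map_star] using h

/-- `A_{∞,α} = η_A(ℓ^∞_α(ℕ, A))`. -/
def seqAlgCont (α : G →* (A ≃⋆ₐ[ℂ] A)) : NonUnitalStarSubalgebra ℂ (SeqAlg A) :=
  (bddSeqCont α).map (etaSeq A)

/-- `F_α(A) = κ_A(A_{∞,α} ∩ A')`, as a ⋆-subalgebra of `F(A)`. -/
def centralSeqCont (α : G →* (A ≃⋆ₐ[ℂ] A)) : NonUnitalStarSubalgebra ℂ (CentralSeqAlg A) :=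
  ((seqAlgCont α).comap (NonUnitalStarSubalgebraClass.subtype (relCommutant A))).map (kappaSeq A)

end Continuous

/-! ## Order zero maps, Rokhlin dimension and Rokhlin systems -/

/-- Orthogonality `a ⊥ b` in a C⋆-algebra. -/
def COrthogonal {B : Type*} [NonUnitalCStarAlgebra B] (a b : B) : Prop :=
  a * b = 0 ∧ b * a = 0 ∧ star a * b = 0 ∧ star b * a = 0

/-- The left translation action of `G` on `C(G)`: `σ_s(f)(t) = f(s⁻¹t)`. -/
def leftTranslate {G : Type*} [Group G] [TopologicalSpace G] [IsTopologicalGroup G] (s : G)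
    (f : C(G, ℂ)) : C(G, ℂ) where
  toFun t := f (s⁻¹ * t)
  continuous_toFun := by fun_prop

section Rokhlin

variable {G A : Type*} [Group G] [TopologicalSpace G] [IsTopologicalGroup G] [CompactSpace G]
  [NonUnitalCStarAlgebra A]

/-- The existence of `d + 1` equivariant c.c.p. order zero maps `φ_j : C(G) → F_α(A)` with
`∑ φ_j(1) = 1`. Complete positivity of a map with range in the C⋆-subalgebra `F_α(A)` may be
tested in `F(A)`; the last clause says that `∑ φ_j(1)` is the unit of `F(A)`. -/
def HasRokhlinTowers (α : G →* (A ≃⋆ₐ[ℂ] A)) (d : ℕ) : Prop :=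
  ∃ φ : Fin (d + 1) → (C(G, ℂ) →CP CentralSeqAlg A),
    (∀ j f, φ j f ∈ centralSeqCont α) ∧
    (∀ j f, ‖φ j f‖ ≤ ‖f‖) ∧
    (∀ j f₁ f₂, COrthogonal f₁ f₂ → COrthogonal (φ j f₁) (φ j f₂)) ∧
    (∀ j s f, centralSeqMap (α s) (φ j f) = φ j (leftTranslate s f)) ∧
    (∀ x : CentralSeqAlg A, (∑ j, φ j 1) * x = x ∧ x * (∑ j, φ j 1) = x)

/-- The Rokhlin dimension of an action: the least `d` for which towers exist, `⊤` if none. -/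
def rokhlinDim (α : G →* (A ≃⋆ₐ[ℂ] A)) : ℕ∞ :=
  ⨅ (d : ℕ) (_ : HasRokhlinTowers α d), (d : ℕ∞)

/-- `ψ` is a `(d, F, K, ε)`-Rokhlin system for the action `α`. -/
structure IsRokhlinSystem [PartialOrder A] [StarOrderedRing A] (α : G →* (A ≃⋆ₐ[ℂ] A)) (d : ℕ)
    (F : Finset A) (K : Finset C(G, ℂ)) (ε : ℝ) (ψ : Fin (d + 1) → (C(G, ℂ) →CP A)) : Prop where
  contractive : ∀ j f, ‖ψ j f‖ ≤ ‖f‖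
  orderZero : ∀ f₁ ∈ K, ∀ f₂ ∈ K, COrthogonal f₁ f₂ → ∀ j, ‖ψ j f₁ * ψ j f₂‖ < ε
  commute : ∀ a ∈ F, ∀ f ∈ K, ∀ j, ‖ψ j f * a - a * ψ j f‖ < ε
  equivariant : ∀ f ∈ K, ∀ s : G, ∀ j, ‖α s (ψ j f) - ψ j (leftTranslate s f)‖ < ε
  unit : ∀ a ∈ F, ‖(∑ j, ψ j 1) * a - a‖ < ε

end Rokhlin

end

/-! Towers in `F(A)` and approximate systems in `A` are translated into each other by passing
between sequences and their classes; each direction has one real obstacle.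

From towers to systems, a c.c.p. map into the quotient `F(A)` has to be lifted to c.c.p. maps into
`A`. No general lifting theorem is needed, because `f` may first be replaced by a finite sum of
`f(t_i) h_i`, with `h_i` a partition of unity on `G` (`exists_partition_approximating_translates`).
Only the finitely many positive elements `φ_j(h_i)` are then lifted, as classes of squares `c_i²` of
self-adjoint sequences in `ℓ^∞_α` (`exists_isSelfAdjoint_lift`). The norm of `F(A)` controls a class
only after multiplication by elements of `A`, so the lift is cut down by a strictly contractive,
`G`-invariant, approximately unital `e`: the maps are `f ↦ ∑ f(t_i) (c_i(n) e)⋆ (c_i(n) e)` for a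
large `n`. They are c.p. because evaluations are characters, and contractive because their value at
`1` has norm below one (`norm_sum_smul_star_mul_self_le`). Uniformity in `s` comes from compactness
of `G` and continuity of the lifts (`eventually_forall_norm_lt`).

From systems to towers, take systems for increasing finite subsets of `S` and of a countable dense
subset of `C(G)`, with errors tending to zero. Their sequence defines maps into `F(A)`, and the
approximate identities become exact on dense or generating sets, then everywhere by closedness.
Orthogonality needs care, since it is a condition on pairs: the dense set must contain enough
orthogonal pairs (`exists_countable_dense_orthogonal`). -/

noncomputable section

/-! ### Positivity and completely positive maps in C⋆-algebras. -/

section CStarGeneral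

theorem CStarAlgebra.exists_eq_star_mul_self {B : Type*} [NonUnitalCStarAlgebra B]
    [PartialOrder B] [StarOrderedRing B] {b : B} (hb : 0 ≤ b) : ∃ x, b = star x * x :=
  CStarAlgebra.nonneg_iff_eq_star_mul_self.1 hb

theorem CStarMatrix.exists_eq_star_mul_self {B n : Type*} [NonUnitalCStarAlgebra B]
    [PartialOrder B] [StarOrderedRing B] [Fintype n] {M : CStarMatrix n n B} (hM : 0 ≤ M) :
    ∃ X : CStarMatrix n n B, M = star X * X :=
  CStarAlgebra.exists_eq_star_mul_self hM

/-- An injective ⋆-homomorphism of C⋆-algebras reflects positivity. -/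
theorem nonneg_of_map_nonneg {B C : Type*} [NonUnitalCStarAlgebra B] [PartialOrder B]
    [StarOrderedRing B] [NonUnitalCStarAlgebra C] [PartialOrder C] [StarOrderedRing C]
    (f : B →⋆ₙₐ[ℂ] C) (hf : Function.Injective f) {b : B} (hb : 0 ≤ f b) : 0 ≤ b := by
  have hsa : IsSelfAdjoint b := by
    apply hf
    rw [map_star, (IsSelfAdjoint.of_nonneg hb).star_eq]
  have hcont : Continuous f := (NonUnitalStarAlgHom.isometry f hf).continuous
  -- The functional calculus commutes with `f`, so `f` kills the negative part of `b`; injectivity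
  -- removes it.
  rw [← CFC.negPart_eq_zero_iff b hsa]
  apply hf
  rw [map_zero, CFC.negPart_def, NonUnitalStarAlgHom.map_cfcₙ (R := ℝ) f (fun x => x⁻) b
    (by fun_prop) (by simp) hcont hsa (IsSelfAdjoint.of_nonneg hb), ← CFC.negPart_def,
    CFC.negPart_eq_zero_iff _ (IsSelfAdjoint.of_nonneg hb)]
  exact hb

/-- Cauchy–Schwarz in the Hilbert module `A^ι`: the sum is the inner product of `(yᵢ⋆)` and `(zᵢ
yᵢ⋆)`. The constant is exactly `r`, so a map `CompletelyPositiveMap.ofCharacters` on `C(G)` built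
from evaluations is contractive as soon as its value at `1` is. -/
theorem norm_sum_smul_star_mul_self_le {A ι : Type*} [NonUnitalCStarAlgebra A] [PartialOrder A]
    [StarOrderedRing A] [Fintype ι] (y : ι → A) (z : ι → ℂ) {r : ℝ} (hr : 0 ≤ r)
    (hz : ∀ i, ‖z i‖ ≤ r) :
    ‖∑ i, z i • (star (y i) * y i)‖ ≤ r * ‖∑ i, star (y i) * y i‖ := by
  let v : WithCStarModule A (ι → A) := WithCStarModule.equiv A (ι → A) |>.symm fun i => star (y i)
  let w : WithCStarModule A (ι → A) := WithCStarModule.equiv A (ι → A) |>.symm fun i => z i • star (y i)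
  have hvw : inner A v w = ∑ i, z i • (star (y i) * y i) := by
    rw [WithCStarModule.pi_inner]
    refine Finset.sum_congr rfl fun i _ => ?_
    rw [WithCStarModule.inner_def]
    simp [v, w, smul_mul_assoc]
  have hv : ‖v‖ ^ 2 = ‖∑ i, star (y i) * y i‖ := by
    rw [WithCStarModule.pi_norm_sq]
    simp [v, WithCStarModule.inner_def]
  have hw : ‖w‖ ^ 2 ≤ r ^ 2 * ‖∑ i, star (y i) * y i‖ := by
    have h1 : ‖w‖ ^ 2 = ‖∑ i, ((‖z i‖ ^ 2 : ℝ) : ℂ) • (star (y i) * y i)‖ := by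
      rw [WithCStarModule.pi_norm_sq]
      congr 1
      refine Finset.sum_congr rfl fun i _ => ?_
      rw [WithCStarModule.inner_def]
      simp [w, smul_smul, ← Complex.conj_mul', mul_smul_comm, smul_mul_assoc]
    have h2 : ‖∑ i, ((r ^ 2 : ℝ) : ℂ) • (star (y i) * y i)‖
        = r ^ 2 * ‖∑ i, star (y i) * y i‖ := by
      rw [← Finset.smul_sum, norm_smul, Complex.norm_real, Real.norm_of_nonneg (by positivity)]
    rw [h1, ← h2]
    have hnn : ∀ (t : ℝ) (i : ι), 0 ≤ t → 0 ≤ (t : ℂ) • (star (y i) * y i) := fun t i ht =>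
      smul_nonneg (by exact_mod_cast ht) (star_mul_self_nonneg _)
    refine CStarAlgebra.norm_le_norm_of_nonneg_of_le
      (Finset.sum_nonneg fun i _ => hnn _ i (by positivity)) (Finset.sum_le_sum fun i _ => ?_)
    rw [← sub_nonneg, ← sub_smul, ← Complex.ofReal_sub]
    refine hnn _ i (sub_nonneg.2 ?_)
    gcongr
    exact hz i
  have hw' : ‖w‖ ≤ r * ‖v‖ := by
    have hv0 : 0 ≤ ‖v‖ := CStarModule.norm_nonneg (A := A)
    refine abs_le_of_sq_le_sq' ?_ (by positivity) |>.2
    rw [mul_pow, hv]; exact hw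
  rw [← hvw, ← hv]
  have hv0 : 0 ≤ ‖v‖ := CStarModule.norm_nonneg (A := A)
  calc ‖inner A v w‖ ≤ ‖v‖ * ‖w‖ := CStarModule.norm_inner_le _
    _ ≤ ‖v‖ * (r * ‖v‖) := by gcongr
    _ = r * ‖v‖ ^ 2 := by ring

/-- The completely positive map `b ↦ ∑ χᵢ(b) yᵢ⋆yᵢ`, for characters `χᵢ`. -/
def CompletelyPositiveMap.ofCharacters {B A ι : Type*} [NonUnitalCStarAlgebra B] [PartialOrder B]
    [StarOrderedRing B] [NonUnitalCStarAlgebra A] [PartialOrder A] [StarOrderedRing A] [Fintype ι]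
    (χ : ι → (B →⋆ₙₐ[ℂ] ℂ)) (y : ι → A) : B →CP A where
  toFun b := ∑ i, χ i b • (star (y i) * y i)
  map_add' f g := by simp [add_smul, Finset.sum_add_distrib]
  map_smul' c f := by simp [mul_smul, Finset.smul_sum]
  map_cstarMatrix_nonneg' k M hM := by
    obtain ⟨X, rfl⟩ := CStarMatrix.exists_eq_star_mul_self hM
    -- Since `χᵢ` is multiplicative and ⋆-preserving, `χᵢ(X⋆X)` with `yᵢ⋆yᵢ` in place of the unit
    -- factors as `Zᵢ⋆Zᵢ`.
    let Z : ι → CStarMatrix (Fin k) (Fin k) A := fun i =>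
      CStarMatrix.ofMatrix fun c a => χ i (X c a) • y i
    have hZ : ∀ i c a, Z i c a = χ i (X c a) • y i := fun _ _ _ => rfl
    have : (star X * X).map (fun b => ∑ i, χ i b • (star (y i) * y i))
        = ∑ i, star (Z i) * Z i := by
      ext a b
      have h : ∀ s : Finset ι, (∑ i ∈ s, star (Z i) * Z i) a b
          = ∑ i ∈ s, (star (Z i) * Z i) a b := by
        intro s
        induction s using Finset.cons_induction with
        | empty => simp
        | cons i s hi ih => rw [Finset.sum_cons, Finset.sum_cons, CStarMatrix.add_apply, ih]
      rw [h, CStarMatrix.map_apply, CStarMatrix.mul_apply]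
      refine Finset.sum_congr rfl fun i _ => ?_
      rw [CStarMatrix.mul_apply, map_sum, Finset.sum_smul]
      refine Finset.sum_congr rfl fun c _ => ?_
      rw [CStarMatrix.star_apply, CStarMatrix.star_apply, hZ, hZ, star_smul, smul_mul_smul_comm,
        map_mul, map_star]
    exact this ▸ Finset.sum_nonneg fun i _ => star_mul_self_nonneg _

end CStarGeneral

theorem NonUnitalStarAlgHom.continuous_of_cstar {B C : Type*} [NonUnitalCStarAlgebra B]
    [NonUnitalCStarAlgebra C] (f : B →⋆ₙₐ[ℂ] C) : Continuous f :=
  AddMonoidHomClass.continuous_of_bound f 1 fun x => by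
    rw [one_mul]; exact NonUnitalStarAlgHom.norm_apply_le f x

/-- A positive element in the range of a ⋆-homomorphism is the image of the square of a
self-adjoint element. -/
theorem NonUnitalStarAlgHom.exists_isSelfAdjoint_map_mul_self_eq {B C : Type*}
    [NonUnitalCStarAlgebra B] [NonUnitalCStarAlgebra C] [PartialOrder C] [StarOrderedRing C]
    (f : B →⋆ₙₐ[ℂ] C) {b₀ : B} (h : 0 ≤ f b₀) :
    ∃ c : B, IsSelfAdjoint c ∧ f (c * c) = f b₀ := by
  have hβs : IsSelfAdjoint (f b₀) := .of_nonneg h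
  let b : B := (1 / 2 : ℂ) • (b₀ + star b₀)
  have hhalf : IsSelfAdjoint (1 / 2 : ℂ) := by simp [IsSelfAdjoint]
  have hbs : IsSelfAdjoint b := hhalf.smul (IsSelfAdjoint.add_star_self b₀)
  have hb : f b = f b₀ := by
    simp only [b, map_smul, map_add, map_star, hβs.star_eq]
    rw [← two_smul ℂ (f b₀), smul_smul]; norm_num
  -- `b` need not be positive: `Real.sqrt` vanishes on negative reals, so the square is the positive
  -- part of `b`, and `f` does not see the difference.
  refine ⟨cfcₙ Real.sqrt b, cfcₙ_predicate _ _, ?_⟩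
  have h1 := NonUnitalStarAlgHom.map_cfcₙ (R := ℝ) f Real.sqrt b
    Real.continuous_sqrt.continuousOn Real.sqrt_zero
    (NonUnitalStarAlgHom.continuous_of_cstar _) hbs (by rw [hb]; exact hβs)
  rw [map_mul, h1, hb, ← cfcₙ_mul Real.sqrt Real.sqrt (f b₀) Real.continuous_sqrt.continuousOn
    Real.sqrt_zero Real.continuous_sqrt.continuousOn Real.sqrt_zero]
  conv_rhs => rw [← cfcₙ_id' ℝ (f b₀)]
  refine cfcₙ_congr fun t ht => ?_
  exact Real.mul_self_sqrt (quasispectrum_nonneg_of_nonneg _ h t ht)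

/-! ### Norms, equality and the unit in `A_∞` and `F(A)`. -/

section SequenceTools

variable {A : Type*} [NonUnitalCStarAlgebra A]

theorem etaSeq_eq_zero_iff {a : BddSeq A} : etaSeq A a = 0 ↔ Tendsto (fun n => a n) atTop (𝓝 0) :=
  (c0Ideal A).mkₗ_eq_zero_iff

theorem etaSeq_eq_iff {a b : BddSeq A} :
    etaSeq A a = etaSeq A b ↔ Tendsto (fun n => a n - b n) atTop (𝓝 0) :=
  (c0Ideal A).mkₗ_eq_iff

theorem kappaSeq_surjective : Function.Surjective (kappaSeq A) := (annIdeal A).mkₗ_surjective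

/-- One-sided products suffice to test the annihilator, since elements of the commutant commute with
`A`. -/
theorem kappaSeq_eq_iff {x y : relCommutant A} : kappaSeq A x = kappaSeq A y ↔
    ∀ a : A, seqIncl A a * (x : SeqAlg A) = seqIncl A a * y := by
  refine (annIdeal A).mkₗ_eq_iff.trans ⟨fun h a => ?_, fun h a => ?_⟩
  · have := (h a).1
    rwa [AddSubgroupClass.coe_sub, mul_sub, sub_eq_zero] at this
  · have hc : seqIncl A a * ((x - y : relCommutant A) : SeqAlg A) = 0 := by
      rw [AddSubgroupClass.coe_sub, mul_sub, h a, sub_self]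
    exact ⟨hc, by rw [← (mem_relCommutant A).1 (x - y).2 a, hc]⟩

/-- Some representative has norm below `r` and differs from `a` by a null sequence. Strict
inequalities in `A_∞` thus descend to coordinates. -/
theorem eventually_norm_lt_of_norm_etaSeq_lt {a : BddSeq A} {r : ℝ} (h : ‖etaSeq A a‖ < r) :
    ∀ᶠ n in atTop, ‖a n‖ < r := by
  obtain ⟨b, hb, hbr⟩ := (c0Ideal A).exists_norm_lt (etaSeq A a) (sub_pos.2 h)
  have hab : Tendsto (fun n => a n - b n) atTop (𝓝 0) := etaSeq_eq_iff.1 hb.symm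
  have hbr' : ‖b‖ < r := by linarith
  filter_upwards [(tendsto_zero_iff_norm_tendsto_zero.1 hab).eventually
    (gt_mem_nhds (sub_pos.2 hbr'))] with n hn
  have h1 : ‖b n‖ ≤ ‖b‖ := lp.norm_apply_le_norm ENNReal.top_ne_zero b n
  have h2 : ‖a n‖ ≤ ‖a n - b n‖ + ‖b n‖ := by simpa using norm_add_le (a n - b n) (b n)
  linarith

theorem norm_seqIncl_le (a : A) : ‖seqIncl A a‖ ≤ ‖a‖ := NonUnitalStarAlgHom.norm_apply_le _ a

/-- The product with `a` does not change when `x` is altered by the annihilator, so `x` can be taken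
with norm close to that of its class. -/
theorem norm_seqIncl_mul_le (a : A) (x : relCommutant A) :
    ‖seqIncl A a * (x : SeqAlg A)‖ ≤ ‖a‖ * ‖kappaSeq A x‖ := by
  refine le_of_forall_pos_le_add fun ε hε => ?_
  obtain ⟨y, hy, hyn⟩ := (annIdeal A).exists_norm_lt (kappaSeq A x)
    (show 0 < ε / (‖a‖ + 1) by positivity)
  rw [← kappaSeq_eq_iff.1 (show kappaSeq A y = kappaSeq A x from hy) a]
  calc ‖seqIncl A a * (y : SeqAlg A)‖ ≤ ‖a‖ * ‖y‖ :=
        (norm_mul_le _ _).trans (by gcongr; exacts [norm_seqIncl_le a, le_rfl])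
    _ ≤ ‖a‖ * (‖kappaSeq A x‖ + ε / (‖a‖ + 1)) := by gcongr
    _ = ‖a‖ * ‖kappaSeq A x‖ + ‖a‖ * (ε / (‖a‖ + 1)) := mul_add _ _ _
    _ ≤ ‖a‖ * ‖kappaSeq A x‖ + ε := by
      gcongr
      rw [mul_div_assoc', div_le_iff₀ (by positivity)]
      nlinarith [norm_nonneg a]

-- By separability there is a sequential approximate unit; its class commutes with `A` and
-- represents the unit of `F(A)`.
variable (A) in
theorem exists_relCommutant_mul_seqIncl [TopologicalSpace.SeparableSpace A] :
    ∃ p : relCommutant A, ∀ a : A, seqIncl A a * (p : SeqAlg A) = seqIncl A a := by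
  let _ : PartialOrder A := CStarAlgebra.spectralOrder A
  have _ : StarOrderedRing A := CStarAlgebra.spectralOrderedRing A
  have hau := CStarAlgebra.increasingApproximateUnit A
  have := hau.neBot
  have hex : ∀ n : ℕ, ∃ e : A, ‖e‖ ≤ 1 ∧ ∀ k ∈ Finset.range (n + 1),
      ‖TopologicalSpace.denseSeq A k * e - TopologicalSpace.denseSeq A k‖ < 1 / (n + 1 : ℝ) ∧
      ‖e * TopologicalSpace.denseSeq A k - TopologicalSpace.denseSeq A k‖ < 1 / (n + 1 : ℝ) := by
    intro n
    have hpos : (0 : ℝ) < 1 / (n + 1 : ℝ) := by positivity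
    have h1 : ∀ᶠ e in CStarAlgebra.approximateUnit A, ∀ k ∈ Finset.range (n + 1),
        ‖TopologicalSpace.denseSeq A k * e - TopologicalSpace.denseSeq A k‖ < 1 / (n + 1 : ℝ) ∧
        ‖e * TopologicalSpace.denseSeq A k - TopologicalSpace.denseSeq A k‖ < 1 / (n + 1 : ℝ) := by
      rw [Filter.eventually_all_finset]
      intro k _
      have hl := Metric.tendsto_nhds.1 (hau.tendsto_mul_left (TopologicalSpace.denseSeq A k)) _ hpos
      have hr := Metric.tendsto_nhds.1 (hau.tendsto_mul_right (TopologicalSpace.denseSeq A k)) _ hpos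
      simp only [dist_eq_norm] at hl hr
      exact hl.and hr
    obtain ⟨e, he1, he2⟩ := (hau.eventually_norm.and h1).exists
    exact ⟨e, he1, he2⟩
  choose e he1 he2 using hex
  let E : BddSeq A := ⟨e, memℓp_infty ⟨1, by rintro _ ⟨n, rfl⟩; exact he1 n⟩⟩
  have hsmall : ∀ k : ℕ, ∀ δ : ℝ, 0 < δ → ∀ᶠ n : ℕ in atTop, k ∈ Finset.range (n + 1) ∧
      1 / (n + 1 : ℝ) < δ := by
    intro k δ hδ
    filter_upwards [eventually_ge_atTop k, (tendsto_one_div_add_atTop_nhds_zero_nat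
      (𝕜 := ℝ)).eventually (gt_mem_nhds hδ)] with n hn hn'
    exact ⟨Finset.mem_range.2 (by omega), hn'⟩
  have hright : ∀ a : A, seqIncl A a * etaSeq A E = seqIncl A a := by
    intro a
    refine (TopologicalSpace.denseRange_denseSeq A).induction_on
      (p := fun a => seqIncl A a * etaSeq A E = seqIncl A a) a ?_ ?_
    · have : Continuous (seqIncl A) := NonUnitalStarAlgHom.continuous_of_cstar _
      exact isClosed_eq (by fun_prop) this
    · intro k
      rw [seqIncl, NonUnitalStarAlgHom.comp_apply, ← map_mul, etaSeq_eq_iff,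
        Metric.tendsto_nhds]
      intro δ hδ
      filter_upwards [hsmall k δ hδ] with n hn
      rw [dist_zero_right]
      exact ((he2 n k hn.1).1).trans hn.2
  have hleft : ∀ a : A, etaSeq A E * seqIncl A a = seqIncl A a := by
    intro a
    refine (TopologicalSpace.denseRange_denseSeq A).induction_on
      (p := fun a => etaSeq A E * seqIncl A a = seqIncl A a) a ?_ ?_
    · have : Continuous (seqIncl A) := NonUnitalStarAlgHom.continuous_of_cstar _
      exact isClosed_eq (by fun_prop) this
    · intro k
      rw [seqIncl, NonUnitalStarAlgHom.comp_apply, ← map_mul, etaSeq_eq_iff,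
        Metric.tendsto_nhds]
      intro δ hδ
      filter_upwards [hsmall k δ hδ] with n hn
      rw [dist_zero_right]
      exact ((he2 n k hn.1).2).trans hn.2
  exact ⟨⟨etaSeq A E, (mem_relCommutant A).2 fun a => (hright a).trans (hleft a).symm⟩, hright⟩

/-- The classes of `x p` and `p` agree for the `p` of the preceding lemma; multiplying by `a`
absorbs `p`. -/
theorem seqIncl_mul_of_kappaSeq_isUnit [TopologicalSpace.SeparableSpace A] {x : relCommutant A}
    (hx : ∀ y : CentralSeqAlg A, kappaSeq A x * y = y) (a : A) :
    seqIncl A a * (x : SeqAlg A) = seqIncl A a := by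
  obtain ⟨p, hp⟩ := exists_relCommutant_mul_seqIncl A
  have h := hx (kappaSeq A p)
  rw [← map_mul, kappaSeq_eq_iff] at h
  have h1 := h a
  rw [MulMemClass.coe_mul, ← mul_assoc, (mem_relCommutant A).1 x.2 a, mul_assoc, hp,
    ← (mem_relCommutant A).1 x.2 a] at h1
  exact h1

end SequenceTools

/-! ### Lifting positive elements of `F_α(A)` to continuous sequences. -/

section ContTools

variable {G A : Type*} [Group G] [TopologicalSpace G] [NonUnitalCStarAlgebra A]

theorem isClosed_bddSeqCont (α : G →* (A ≃⋆ₐ[ℂ] A)) :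
    IsClosed (bddSeqCont α : Set (BddSeq A)) := by
  refine isClosed_of_closure_subset fun a ha => ?_
  refine continuous_of_uniform_approx_of_continuous ?_
  rw [Metric.uniformity_basis_dist.forall_iff (fun _ _ hst h => by
    obtain ⟨F, hF, hF'⟩ := h
    exact ⟨F, hF, fun y => hst (hF' y)⟩)]
  intro ε hε
  obtain ⟨b, hb, hab⟩ := Metric.mem_closure_iff.1 ha ε hε
  refine ⟨fun g => bddSeqMap (α g) b, hb, fun g => ?_⟩
  change dist (bddSeqMap (α g) a) (bddSeqMap (α g) b) < ε
  rw [dist_eq_norm, ← map_sub]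
  rw [dist_eq_norm] at hab
  exact (NonUnitalStarAlgHom.norm_apply_le _ _).trans_lt hab

theorem mem_bddSeqCont {α : G →* (A ≃⋆ₐ[ℂ] A)} {a : BddSeq A} :
    a ∈ bddSeqCont α ↔ Continuous fun g => bddSeqMap (α g) a := Iff.rfl

/-- A positive element of `F_α(A)` is the image of the square of a self-adjoint element of
`ℓ^∞_α(ℕ, A)`. -/
theorem exists_isSelfAdjoint_lift {α : G →* (A ≃⋆ₐ[ℂ] A)} {β : CentralSeqAlg A} (hβ : 0 ≤ β)
    (hβα : β ∈ centralSeqCont α) :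
    ∃ c : BddSeq A, c ∈ bddSeqCont α ∧ IsSelfAdjoint c ∧
      ∃ x : relCommutant A, (x : SeqAlg A) = etaSeq A (c * c) ∧ kappaSeq A x = β := by
  obtain ⟨x₀, ⟨b₀, hb₀, hbx₀⟩, hxβ₀⟩ := hβα
  have hbx₀' : etaSeq A b₀ = x₀ := hbx₀
  have hxβ₀' : kappaSeq A x₀ = β := hxβ₀
  -- `T` is closed, hence a C⋆-algebra, so the square root of the lift, taken inside `T`, keeps both
  -- centrality and continuity.
  let T : NonUnitalStarSubalgebra ℂ (BddSeq A) :=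
    (relCommutant A).comap (etaSeq A) ⊓ bddSeqCont α
  have : IsClosed (T : Set (BddSeq A)) :=
    ((relCommutant_isClosed A).preimage
      (NonUnitalStarAlgHom.continuous_of_cstar (etaSeq A))).inter
      (isClosed_bddSeqCont α)
  let f : T →⋆ₙₐ[ℂ] relCommutant A := NonUnitalStarAlgHom.codRestrict
    ((etaSeq A).comp (NonUnitalStarSubalgebraClass.subtype T)) (relCommutant A) fun t => t.2.1
  let b : T := ⟨b₀, by change etaSeq A b₀ ∈ relCommutant A; rw [hbx₀']; exact x₀.2, hb₀⟩
  have hfb : f b = x₀ := Subtype.ext hbx₀'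
  have hb : ((kappaSeq A).comp f) b = β := by
    rw [NonUnitalStarAlgHom.comp_apply, hfb, hxβ₀']
  obtain ⟨c, hcs, hc⟩ := NonUnitalStarAlgHom.exists_isSelfAdjoint_map_mul_self_eq
    ((kappaSeq A).comp f) (b₀ := b) (hb.symm ▸ hβ)
  exact ⟨c, c.2.2, congrArg Subtype.val hcs, f (c * c), rfl, hc.trans hb⟩

end ContTools

/-! ### Invariant approximate units and uniformity over compact spaces. -/

section InvariantApproxUnit

variable {G A : Type*} [NonUnitalCStarAlgebra A]

/-- Multiplication by contractions is equicontinuous, so pointwise convergence of the approximate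
unit is uniform on compact sets. -/
theorem IsCompact.eventually_approximateUnit [PartialOrder A] [StarOrderedRing A] {K : Set A}
    (hK : IsCompact K) {δ : ℝ} (hδ : 0 < δ) : ∀ᶠ e in CStarAlgebra.approximateUnit A,
      ∀ x ∈ K, ‖e * x - x‖ < δ ∧ ‖x * e - x‖ < δ := by
  have hau := CStarAlgebra.increasingApproximateUnit A
  refine hK.induction_on (p := fun s => ∀ᶠ e in CStarAlgebra.approximateUnit A,
      ∀ x ∈ s, ‖e * x - x‖ < δ ∧ ‖x * e - x‖ < δ) (by simp) ?_ ?_ ?_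
  · exact fun s t hst h => h.mono fun e he x hx => he x (hst hx)
  · exact fun s t hs ht => (hs.and ht).mono fun e he x hx => hx.elim (he.1 x) (he.2 x)
  · intro x _
    refine ⟨Metric.ball x (δ / 3), mem_nhdsWithin_of_mem_nhds (Metric.ball_mem_nhds x (by positivity)),
      ?_⟩
    have hl := Metric.tendsto_nhds.1 (hau.tendsto_mul_left x) _ (show 0 < δ / 3 by positivity)
    have hr := Metric.tendsto_nhds.1 (hau.tendsto_mul_right x) _ (show 0 < δ / 3 by positivity)
    filter_upwards [hl, hr, hau.eventually_norm] with e hel her hen y hy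
    rw [dist_eq_norm] at hel her
    rw [Metric.mem_ball, dist_eq_norm] at hy
    have h1 : ‖e * (y - x)‖ ≤ ‖y - x‖ := (norm_mul_le _ _).trans
      (mul_le_of_le_one_left (norm_nonneg _) hen)
    have h2 : ‖(y - x) * e‖ ≤ ‖y - x‖ := (norm_mul_le _ _).trans
      (mul_le_of_le_one_right (norm_nonneg _) hen)
    constructor
    · calc ‖e * y - y‖ = ‖e * (y - x) + (e * x - x) - (y - x)‖ := by
            congr 1; rw [mul_sub]; abel
        _ ≤ ‖e * (y - x)‖ + ‖e * x - x‖ + ‖y - x‖ :=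
          (norm_sub_le _ _).trans (by gcongr; exact norm_add_le _ _)
        _ < δ := by linarith
    · calc ‖y * e - y‖ = ‖(y - x) * e + (x * e - x) - (y - x)‖ := by
            congr 1; rw [sub_mul]; abel
        _ ≤ ‖(y - x) * e‖ + ‖x * e - x‖ + ‖y - x‖ :=
          (norm_sub_le _ _).trans (by gcongr; exact norm_add_le _ _)
        _ < δ := by linarith

theorem norm_starAlgEquiv_apply (θ : A ≃⋆ₐ[ℂ] A) (a : A) : ‖θ a‖ = ‖a‖ :=
  NonUnitalStarAlgHom.norm_map θ θ.injective a

variable [Group G] [TopologicalSpace G] [IsTopologicalGroup G] [CompactSpace G]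

/-- For an action of a compact group, approximate units can be averaged to invariant ones. -/
theorem exists_invariant_approximateUnit (α : G →* (A ≃⋆ₐ[ℂ] A))
    (hα : ∀ a : A, Continuous fun g => α g a) (F : Finset A) {δ : ℝ} (hδ : 0 < δ) :
    ∃ e : A, ‖e‖ ≤ 1 ∧ (∀ s, α s e = e) ∧ ∀ a ∈ F, ‖e * a - a‖ ≤ δ ∧ ‖a * e - a‖ ≤ δ := by
  let _ : PartialOrder A := CStarAlgebra.spectralOrder A
  have _ : StarOrderedRing A := CStarAlgebra.spectralOrderedRing A
  have hau := CStarAlgebra.increasingApproximateUnit A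
  have := hau.neBot
  -- If `u` is almost a unit on whole orbits, then every `α g u` is almost a unit on `F`, and so is
  -- their Haar average, which is invariant.
  have hK : IsCompact (⋃ a ∈ F, Set.range fun g => α g a) :=
    F.isCompact_biUnion fun a _ => isCompact_range (hα a)
  obtain ⟨u, hu1, hu⟩ := (hau.eventually_norm.and (hK.eventually_approximateUnit hδ)).exists
  let _ : MeasurableSpace G := borel G
  have _ : BorelSpace G := ⟨rfl⟩
  let μ : MeasureTheory.Measure G := MeasureTheory.Measure.haarMeasure ⊤
  have hμ : MeasureTheory.IsProbabilityMeasure μ := ⟨by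
    simpa using MeasureTheory.Measure.haarMeasure_self (K₀ := (⊤ : TopologicalSpace.PositiveCompacts G))⟩
  have hint : ∀ f : G → A, Continuous f → MeasureTheory.Integrable f μ := fun f hf =>
    hf.integrable_of_hasCompactSupport (HasCompactSupport.of_compactSpace f)
  have hua : ∀ a ∈ F, ∀ g, ‖α g u * a - a‖ ≤ δ ∧ ‖a * α g u - a‖ ≤ δ := by
    intro a ha g
    have hmem : α g⁻¹ a ∈ ⋃ a ∈ F, Set.range fun g => α g a :=
      Set.mem_biUnion ha ⟨g⁻¹, rfl⟩
    have hg : α g (α g⁻¹ a) = a := by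
      rw [← StarAlgEquiv.mul_apply, ← map_mul, mul_inv_cancel, map_one, StarAlgEquiv.one_apply]
    have h := hu _ hmem
    rw [← norm_starAlgEquiv_apply (α g), map_sub, map_mul, hg,
      ← norm_starAlgEquiv_apply (α g) (_ * u - _), map_sub, map_mul, hg] at h
    exact ⟨h.1.le, h.2.le⟩
  refine ⟨∫ g, α g u ∂μ, ?_, ?_, ?_⟩
  · refine (MeasureTheory.norm_integral_le_of_norm_le_const (C := 1)
      (Eventually.of_forall fun g => ?_)).trans (by simp)
    rw [norm_starAlgEquiv_apply]; exact hu1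
  · intro s
    let L : A →L[ℂ] A := ⟨(α s : A →ₗ[ℂ] A), (NonUnitalStarAlgHom.continuous_of_cstar (α s : A →⋆ₙₐ[ℂ] A))⟩
    calc α s (∫ g, α g u ∂μ) = L (∫ g, α g u ∂μ) := rfl
      _ = ∫ g, L (α g u) ∂μ := (L.integral_comp_comm (hint _ (hα u))).symm
      _ = ∫ g, α (s * g) u ∂μ := by
        congr 1; ext g; rw [map_mul]; rfl
      _ = ∫ g, α g u ∂μ := MeasureTheory.integral_mul_left_eq_self (fun g => α g u) s
  · intro a ha
    have hconst : ∫ _ : G, a ∂μ = a := by simp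
    constructor
    · let L : A →L[ℂ] A := (ContinuousLinearMap.mul ℂ A).flip a
      have : (∫ g, α g u ∂μ) * a - a = ∫ g, (α g u * a - a) ∂μ := by
        rw [MeasureTheory.integral_sub (hint (fun g => α g u * a) ((hα u).mul continuous_const))
          (hint _ continuous_const), hconst]
        exact congrArg (· - a) (L.integral_comp_comm (hint _ (hα u))).symm
      rw [this]
      exact (MeasureTheory.norm_integral_le_of_norm_le_const
        (Eventually.of_forall fun g => (hua a ha g).1)).trans (by simp)
    · let L : A →L[ℂ] A := (ContinuousLinearMap.mul ℂ A) a
      have : a * (∫ g, α g u ∂μ) - a = ∫ g, (a * α g u - a) ∂μ := by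
        rw [MeasureTheory.integral_sub (hint (fun g => a * α g u) (continuous_const.mul (hα u)))
          (hint _ continuous_const), hconst]
        exact congrArg (· - a) (L.integral_comp_comm (hint _ (hα u))).symm
      rw [this]
      exact (MeasureTheory.norm_integral_le_of_norm_le_const
        (Eventually.of_forall fun g => (hua a ha g).2)).trans (by simp)

/-- Continuity for the supremum norm makes an index valid at `s` valid near `s`, at the price of a
slightly larger bound; compactness then gives one index for all `s`. -/
theorem eventually_forall_norm_lt {X : Type*} [TopologicalSpace X] [CompactSpace X]
    {f : X → BddSeq A} (hf : Continuous f) {r : ℝ} (h : ∀ s, ‖etaSeq A (f s)‖ < r) :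
    ∀ᶠ n in atTop, ∀ s, ‖f s n‖ < r := by
  have key := (isCompact_univ (X := X)).induction_on
    (p := fun S => ∀ᶠ n in atTop, ∀ s ∈ S, ‖f s n‖ < r) (by simp)
    (fun S T hST h => h.mono fun n hn s hs => hn s (hST hs))
    (fun S T hS hT => (hS.and hT).mono fun n hn s hs => hs.elim (hn.1 s) (hn.2 s)) ?_
  · exact key.mono fun n hn s => hn s trivial
  intro s _
  obtain ⟨r', hr', hr'r⟩ := exists_between (h s)
  refine ⟨{t | dist (f t) (f s) < r - r'}, mem_nhdsWithin_of_mem_nhds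
    (hf.continuousAt.eventually (Metric.ball_mem_nhds (f s) (sub_pos.2 hr'r))), ?_⟩
  filter_upwards [eventually_norm_lt_of_norm_etaSeq_lt hr'] with n hn t ht
  have h1 : ‖f t n - f s n‖ ≤ ‖f t - f s‖ :=
    lp.norm_apply_le_norm ENNReal.top_ne_zero (f t - f s) n
  have h2 : ‖f t n‖ ≤ ‖f t n - f s n‖ + ‖f s n‖ := by
    simpa using norm_add_le (f t n - f s n) (f s n)
  rw [dist_eq_norm] at ht
  linarith

end InvariantApproxUnit

/-! ### Partitions of unity adapted to all translates. -/

section PartitionOfUnity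

variable {G : Type*} [Group G] [TopologicalSpace G] [IsTopologicalGroup G] [CompactSpace G]
  [T2Space G]

/-- The cover consists of sets `xV`, with `V` so small that `f(t)` and `f(tv)` are close for all
`t`. Left translation commutes with right multiplication by `v`, so one partition serves every `s`.
-/
theorem exists_partition_approximating_translates (K : Finset C(G, ℂ)) {δ : ℝ} (hδ : 0 < δ) :
    ∃ (T : Finset G) (h : T → C(G, ℂ)), (∀ i : T, 0 ≤ h i) ∧ ∑ i : T, h i = 1 ∧
      ∀ f ∈ K, ∀ s, ‖leftTranslate s f - ∑ i : T, leftTranslate s f i • h i‖ ≤ δ := by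
  have hV : ∀ᶠ v in 𝓝 (1 : G), ∀ f ∈ K, ∀ t, ‖f t - f (t * v)‖ < δ := by
    rw [Filter.eventually_all_finset]
    intro f _
    have := (isCompact_univ (X := G)).eventually_forall_of_forall_eventually (x₀ := (1 : G))
      (P := fun v t => ‖f t - f (t * v)‖ < δ) fun t _ => by
        have hc : Continuous fun z : G × G => ‖f z.2 - f (z.2 * z.1)‖ := by fun_prop
        exact hc.continuousAt.eventually (gt_mem_nhds (by simpa using hδ))
    exact this.mono fun v hv t => hv t trivial
  obtain ⟨V, hVK, hVo, hV1⟩ := eventually_nhds_iff.1 hV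
  let U : G → Set G := fun x => {t | x⁻¹ * t ∈ V}
  have hUo : ∀ x, IsOpen (U x) := fun x => hVo.preimage (by fun_prop)
  obtain ⟨T, hT⟩ := (isCompact_univ (X := G)).elim_finite_subcover U hUo
    (fun x _ => Set.mem_iUnion.2 ⟨x, by simpa [U] using hV1⟩)
  obtain ⟨ρ, hρ⟩ := PartitionOfUnity.exists_isSubordinate isClosed_univ (fun i : T => U i)
    (fun i => hUo i) (fun t ht => by simpa using hT ht)
  refine ⟨T, fun i => ⟨fun t => (ρ i t : ℂ), by fun_prop⟩, ?_, ?_, ?_⟩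
  · intro i t
    simpa using ρ.nonneg i t
  · ext t
    have := ρ.sum_eq_one (Set.mem_univ t)
    rw [finsum_eq_sum_of_fintype] at this
    rw [ContinuousMap.sum_apply]
    change ∑ i, (ρ i t : ℂ) = 1
    exact_mod_cast congrArg (fun x : ℝ => (x : ℂ)) this
  · intro f hf s
    rw [ContinuousMap.norm_le _ hδ.le]
    intro t
    have hsum : ∑ i, (ρ i t : ℂ) = 1 := by
      have := ρ.sum_eq_one (Set.mem_univ t)
      rw [finsum_eq_sum_of_fintype] at this
      exact_mod_cast congrArg (fun x : ℝ => (x : ℂ)) this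
    have hsumr : ∑ i, ρ i t = 1 := by exact_mod_cast hsum
    have hdec : (leftTranslate s f - ∑ i : T, leftTranslate s f i •
        (⟨fun t => (ρ i t : ℂ), by fun_prop⟩ : C(G, ℂ))) t
        = ∑ i : T, (ρ i t : ℂ) * (leftTranslate s f t - leftTranslate s f i) := by
      simp only [ContinuousMap.sub_apply, ContinuousMap.sum_apply, ContinuousMap.smul_apply,
        ContinuousMap.coe_mk, mul_sub, Finset.sum_sub_distrib, ← Finset.sum_mul, hsum, one_mul,
        smul_eq_mul]
      simp only [mul_comm]
    rw [hdec]
    calc ‖∑ i : T, (ρ i t : ℂ) * (leftTranslate s f t - leftTranslate s f i)‖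
        ≤ ∑ i : T, ρ i t * δ := by
          refine norm_sum_le_of_le _ fun i _ => ?_
          rw [norm_mul, Complex.norm_real, Real.norm_of_nonneg (ρ.nonneg i t)]
          rcases eq_or_ne (ρ i t) 0 with h0 | h0
          · simp [h0]
          have ht : t ∈ U i := hρ i (subset_closure h0)
          have := hVK _ ht f hf (s⁻¹ * i)
          rw [mul_assoc, mul_inv_cancel_left, norm_sub_rev] at this
          exact mul_le_mul_of_nonneg_left this.le (ρ.nonneg i t)
      _ = δ := by rw [← Finset.sum_mul, hsumr, one_mul]

end PartitionOfUnity

/-! ### From Rokhlin towers to Rokhlin systems. -/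

section TowersToSystems

variable {G A : Type*} [NonUnitalCStarAlgebra A]

/-- Averaged approximate units, shrunk to have norm less than one. -/
theorem exists_invariant_star_mul_self [Group G] [TopologicalSpace G] [IsTopologicalGroup G]
    [CompactSpace G] (α : G →* (A ≃⋆ₐ[ℂ] A)) (hα : ∀ a : A, Continuous fun g => α g a)
    (F : Finset A) {δ : ℝ} (hδ : 0 < δ) :
    ∃ e : A, ‖star e * e‖ < 1 ∧ (∀ s, α s e = e) ∧
      ∀ a ∈ F, ‖star e * e * a - a‖ ≤ δ ∧ ‖a * (star e * e) - a‖ ≤ δ := by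
  classical
  obtain ⟨M, hM⟩ : ∃ M : ℝ, ∀ a ∈ F, ‖a‖ ≤ M := by
    obtain ⟨M, hM⟩ := (F.image norm).bddAbove
    exact ⟨M, fun a ha => hM (by simpa using ⟨a, ha, rfl⟩)⟩
  -- Scaling by `t` makes the norm strictly less than one, as is needed to pass from a norm in `A_∞`
  -- to coordinates. Its cost `δ / 3` adds to `δ / 3` for each of `e` and `star e`.
  obtain ⟨t, ht0, ht1, htM⟩ : ∃ t : ℝ, 0 < t ∧ t < 1 ∧ (1 - t ^ 2) * M ≤ δ / 3 := by
    have hc : Tendsto (fun t : ℝ => (1 - t ^ 2) * M) (𝓝[<] 1) (𝓝 ((1 - 1 ^ 2) * M)) :=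
      (Continuous.tendsto (by fun_prop) 1).mono_left nhdsWithin_le_nhds
    have h1 := hc.eventually (gt_mem_nhds (show (1 - 1 ^ 2) * M < δ / 3 by norm_num; positivity))
    have h2 : ∀ᶠ t : ℝ in 𝓝[<] 1, 0 < t :=
      (eventually_gt_nhds zero_lt_one).filter_mono nhdsWithin_le_nhds
    have h3 : ∀ᶠ t : ℝ in 𝓝[<] 1, t < 1 := eventually_mem_nhdsWithin
    obtain ⟨t, h⟩ := (h1.and (h2.and h3)).exists
    exact ⟨t, h.2.1, h.2.2, h.1.le⟩
  obtain ⟨e, he1, heα, heF⟩ := exists_invariant_approximateUnit α hα (F ∪ F.image star)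
    (show 0 < δ / 3 by positivity)
  have hstar : star ((t : ℂ) • e) * ((t : ℂ) • e) = ((t ^ 2 : ℝ) : ℂ) • (star e * e) := by
    rw [star_smul, smul_mul_smul_comm]
    congr 1
    simp [sq]
  have hcut : ∀ a b : A, ‖b - a‖ ≤ 2 * (δ / 3) → ‖a‖ ≤ M → ‖((t ^ 2 : ℝ) : ℂ) • b - a‖ ≤ δ := by
    intro a b hab ha
    have h1 : ((t ^ 2 : ℝ) : ℂ) • b - a
        = ((t ^ 2 : ℝ) : ℂ) • (b - a) - ((1 - t ^ 2 : ℝ) : ℂ) • a := by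
      push_cast
      rw [smul_sub, sub_smul, one_smul]; abel
    have ht2 : t ^ 2 ≤ 1 := by nlinarith
    rw [h1]
    calc _ ≤ ‖((t ^ 2 : ℝ) : ℂ) • (b - a)‖ + ‖((1 - t ^ 2 : ℝ) : ℂ) • a‖ := norm_sub_le _ _
      _ = t ^ 2 * ‖b - a‖ + (1 - t ^ 2) * ‖a‖ := by
        rw [norm_smul, norm_smul, Complex.norm_real, Complex.norm_real,
          Real.norm_of_nonneg (by positivity), Real.norm_of_nonneg (by linarith)]
      _ ≤ 1 * (2 * (δ / 3)) + (1 - t ^ 2) * M := by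
        gcongr
      _ ≤ δ := by linarith
  have hse : ‖star e‖ ≤ 1 := by rwa [norm_star]
  have hee : ‖star e * e‖ ≤ 1 := by
    rw [CStarRing.norm_star_mul_self]; nlinarith [norm_nonneg e]
  refine ⟨(t : ℂ) • e, ?_, fun s => by rw [map_smul, heα], fun a ha => ?_⟩
  · rw [hstar, norm_smul, Complex.norm_real, Real.norm_of_nonneg (by positivity)]
    nlinarith [norm_nonneg (star e * e)]
  · have h1 := heF a (Finset.mem_union_left _ ha)
    have h2 := heF (star a) (Finset.mem_union_right _ (Finset.mem_image_of_mem _ ha))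
    have h3 : ‖star e * a - a‖ ≤ δ / 3 := by
      rw [← norm_star]; simpa using h2.2
    have h4 : ‖a * star e - a‖ ≤ δ / 3 := by
      rw [← norm_star]; simpa using h2.1
    rw [hstar, smul_mul_assoc, mul_smul_comm]
    constructor
    · refine hcut _ _ ?_ (hM a ha)
      calc ‖star e * e * a - a‖ = ‖star e * (e * a - a) + (star e * a - a)‖ := by
            congr 1; rw [mul_sub, mul_assoc]; abel
        _ ≤ ‖star e‖ * ‖e * a - a‖ + ‖star e * a - a‖ :=
          (norm_add_le _ _).trans (by gcongr; exact norm_mul_le _ _)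
        _ ≤ 1 * (δ / 3) + δ / 3 := by gcongr; exact h1.1
        _ = 2 * (δ / 3) := by ring
    · refine hcut _ _ ?_ (hM a ha)
      calc ‖a * (star e * e) - a‖ = ‖(a * star e - a) * e + (a * e - a)‖ := by
            congr 1; rw [sub_mul, mul_assoc]; abel
        _ ≤ ‖a * star e - a‖ * ‖e‖ + ‖a * e - a‖ :=
          (norm_add_le _ _).trans (by gcongr; exact norm_mul_le _ _)
        _ ≤ δ / 3 * 1 + δ / 3 := by gcongr; exact h1.2
        _ = 2 * (δ / 3) := by ring

/-- The sequence `∑ zᵢ e⋆ cᵢ² e`. -/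
def cutSeq {ι : Type*} [Fintype ι] (c : ι → BddSeq A) (e : A) (z : ι → ℂ) : BddSeq A :=
  ∑ i, z i • (star (constSeq A e) * (c i * c i) * constSeq A e)

theorem cutSeq_apply {ι : Type*} [Fintype ι] (c : ι → BddSeq A) (hc : ∀ i, IsSelfAdjoint (c i))
    (e : A) (z : ι → ℂ) (n : ℕ) :
    cutSeq c e z n = ∑ i, z i • (star (c i n * e) * (c i n * e)) := by
  have hcn : ∀ i, star (c i n) = c i n := fun i =>
    congrFun (congrArg (fun a : BddSeq A => (a : ℕ → A)) (hc i)) n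
  rw [cutSeq, lp.coeFn_sum, Finset.sum_apply]
  refine Finset.sum_congr rfl fun i _ => ?_
  rw [star_mul, hcn]
  change z i • (star e * (c i n * c i n) * e) = _
  simp only [mul_assoc]

/-- In `A_∞` the `x i` commute with `e`, so the two-sided cut becomes multiplication by `e⋆e`, to
which `norm_seqIncl_mul_le` applies; in coordinates it keeps the form `y⋆y`. -/
theorem etaSeq_cutSeq {ι : Type*} [Fintype ι] {c : ι → BddSeq A} {x : ι → relCommutant A}
    (hx : ∀ i, (x i : SeqAlg A) = etaSeq A (c i * c i)) (e : A) (z : ι → ℂ) :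
    etaSeq A (cutSeq c e z)
      = seqIncl A (star e * e) * ((∑ i, z i • x i : relCommutant A) : SeqAlg A) := by
  rw [cutSeq, map_sum, AddSubmonoidClass.coe_finsetSum, Finset.mul_sum]
  refine Finset.sum_congr rfl fun i _ => ?_
  rw [map_smul, SetLike.val_smul, mul_smul_comm, map_mul, map_mul, ← hx, map_star]
  change _ • (star (seqIncl A e) * x i * seqIncl A e) = _
  rw [mul_assoc, ← (mem_relCommutant A).1 (x i).2 e, map_mul, map_star, mul_assoc]

theorem continuous_cutSeq {X ι : Type*} [TopologicalSpace X] [Fintype ι] (c : ι → BddSeq A) (e : A)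
    {z : X → ι → ℂ} (hz : ∀ i, Continuous fun s => z s i) : Continuous fun s => cutSeq c e (z s) :=
  continuous_finsetSum _ fun i _ => (hz i).smul continuous_const

theorem cutSeq_mem_bddSeqCont {ι : Type*} [Fintype ι] [Group G] [TopologicalSpace G]
    {α : G →* (A ≃⋆ₐ[ℂ] A)} {c : ι → BddSeq A} (hc : ∀ i, c i ∈ bddSeqCont α) {e : A}
    (he : ∀ s, α s e = e) (z : ι → ℂ) : cutSeq c e z ∈ bddSeqCont α := by
  have hE : constSeq A e ∈ bddSeqCont α := by
    have : (fun g => bddSeqMap (α g) (constSeq A e)) = fun _ => constSeq A e := by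
      ext g n; exact he g
    rw [mem_bddSeqCont, this]
    exact continuous_const
  exact sum_mem fun i _ => SMulMemClass.smul_mem _ (mul_mem (mul_mem (star_mem hE)
    (mul_mem (hc i) (hc i))) hE)

theorem leftTranslate_one [Group G] [TopologicalSpace G] [IsTopologicalGroup G] (f : C(G, ℂ)) :
    leftTranslate 1 f = f := by
  ext t; simp [leftTranslate]

/-- Evaluation at a point as a character. -/
def evalCharacter {X : Type*} [TopologicalSpace X] (x : X) : C(X, ℂ) →⋆ₙₐ[ℂ] ℂ where
  toFun f := f x
  map_smul' _ _ := rfl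
  map_zero' := rfl
  map_add' _ _ := rfl
  map_mul' _ _ := rfl
  map_star' _ := rfl

end TowersToSystems

section TowersToSystems

variable {G A : Type*} [Group G] [TopologicalSpace G] [IsTopologicalGroup G] [CompactSpace G]
  [NonUnitalCStarAlgebra A]

theorem centralSeqMap_kappaSeq (θ : A ≃⋆ₐ[ℂ] A) (x : relCommutant A) :
    centralSeqMap θ (kappaSeq A x) = kappaSeq A (relCommutantMap θ x) := rfl

theorem HasRokhlinTowers.exists_isRokhlinSystem [T2Space G] [TopologicalSpace.SeparableSpace A]
    [PartialOrder A] [StarOrderedRing A] {α : G →* (A ≃⋆ₐ[ℂ] A)}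
    (hα : ∀ a : A, Continuous fun g => α g a) {d : ℕ} (h : HasRokhlinTowers α d)
    (F : Finset A) (K : Finset C(G, ℂ)) {ε : ℝ} (hε : 0 < ε) :
    ∃ ψ : Fin (d + 1) → (C(G, ℂ) →CP A), IsRokhlinSystem α d F K ε ψ := by
  obtain ⟨φ, hφα, hφn, hφ0, hφe, hφ1⟩ := h
  obtain ⟨M, hM1, hMK⟩ : ∃ M : ℝ, 1 ≤ M ∧ ∀ f ∈ K, ‖f‖ + 1 ≤ M := by
    obtain ⟨M, hM⟩ := (K.image norm).bddAbove
    exact ⟨max 1 (M + 1), le_max_left _ _, fun f hf =>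
      (add_le_add_left (hM (by simpa using ⟨f, hf, rfl⟩)) 1).trans (le_max_right _ _)⟩
  -- `M` will bound `f` and its approximation `P f`; every error below is at most `2 * M * δ`.
  obtain ⟨δ, hδ, hδ1, hδε⟩ : ∃ δ : ℝ, 0 < δ ∧ δ ≤ 1 ∧ 2 * M * δ < ε :=
    ⟨min 1 (ε / (4 * M)), by positivity, min_le_left _ _, by
      calc 2 * M * min 1 (ε / (4 * M)) ≤ 2 * M * (ε / (4 * M)) := by gcongr; exact min_le_right _ _
        _ = ε / 2 := by field_simp; norm_num
        _ < ε := half_lt_self hε⟩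
  have hδM : δ ≤ M * δ := le_mul_of_one_le_left hδ.le hM1
  obtain ⟨T, p, hp0, hp1, hpK⟩ := exists_partition_approximating_translates K hδ
  have hβ : ∀ j (i : T), 0 ≤ φ j (p i) := fun j i => by
    simpa using OrderHomClass.mono (φ j) (hp0 i)
  choose c hcα hcs x hx hxφ using fun j i => exists_isSelfAdjoint_lift (hβ j i) (hφα j (p i))
  obtain ⟨e, he1, heα, heF⟩ := exists_invariant_star_mul_self α hα F hδ
  let P : C(G, ℂ) → C(G, ℂ) := fun f => ∑ i : T, f i • p i
  let X : Fin (d + 1) → C(G, ℂ) → relCommutant A := fun j f => ∑ i : T, f i • x j i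
  let W : Fin (d + 1) → C(G, ℂ) → BddSeq A := fun j f => cutSeq (c j) e fun i => f i
  have hP : ∀ f ∈ K, ∀ s, ‖leftTranslate s f - P (leftTranslate s f)‖ ≤ δ := hpK
  have hP' : ∀ f ∈ K, ‖f - P f‖ ≤ δ := fun f hf => by
    simpa only [leftTranslate_one] using hP f hf 1
  have hPn : ∀ f ∈ K, ‖P f‖ ≤ M := fun f hf => by
    have h1 : ‖P f‖ ≤ ‖f‖ + ‖f - P f‖ := by
      simpa using norm_sub_le f (f - P f)
    linarith [hP' f hf, hMK f hf]
  have hXφ : ∀ j f, kappaSeq A (X j f) = φ j (P f) := fun j f => by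
    simp only [X, P, map_sum, map_smul, hxφ]
  have hW : ∀ j f, etaSeq A (W j f) = seqIncl A (star e * e) * (X j f : SeqAlg A) := fun j f =>
    etaSeq_cutSeq (hx j) e _
  have hP1 : P 1 = 1 := (Finset.sum_congr rfl fun i _ => one_smul ℂ (p i)).trans hp1
  let ψ : ℕ → Fin (d + 1) → (C(G, ℂ) →CP A) := fun n j =>
    CompletelyPositiveMap.ofCharacters (fun i : T => evalCharacter (i : G)) fun i => c j i n * e
  have hψW : ∀ n j f, ψ n j f = W j f n := fun n j f => (cutSeq_apply (c j) (hcs j) e _ n).symm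
  have hmul : ∀ (a : A) (y : relCommutant A) (r : ℝ), ‖kappaSeq A y‖ ≤ r →
      ‖seqIncl A a * (y : SeqAlg A)‖ ≤ ‖a‖ * r := fun a y r hy =>
    (norm_seqIncl_mul_le a y).trans (by gcongr)
  -- The value at `1` alone will give contractivity on all of `C(G)`, not just on `K`.
  have ev1 : ∀ᶠ n in atTop, ∀ j, ‖W j 1 n‖ < 1 := by
    refine eventually_all.2 fun j => eventually_norm_lt_of_norm_etaSeq_lt ?_
    rw [hW]
    have h1 : ‖(1 : C(G, ℂ))‖ ≤ 1 := (ContinuousMap.norm_le _ zero_le_one).2 fun t => by simp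
    refine (hmul _ _ 1 ?_).trans_lt (by rwa [mul_one])
    rw [hXφ, hP1]
    exact (hφn j 1).trans h1
  have ev2 : ∀ᶠ n in atTop, ∀ f₁ ∈ K, ∀ f₂ ∈ K, COrthogonal f₁ f₂ → ∀ j,
      ‖W j f₁ n * W j f₂ n‖ < ε := by
    refine (eventually_all_finset _).2 fun f₁ h₁ => (eventually_all_finset _).2 fun f₂ h₂ => ?_
    refine eventually_imp_distrib_left.2 fun hf => eventually_all.2 fun j => ?_
    refine eventually_norm_lt_of_norm_etaSeq_lt (a := W j f₁ * W j f₂) ?_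
    have heq : etaSeq A (W j f₁ * W j f₂) = seqIncl A ((star e * e) * (star e * e)) *
        ((X j f₁ * X j f₂ : relCommutant A) : SeqAlg A) := by
      rw [map_mul, hW, hW]
      generalize star e * e = b
      rw [map_mul, MulMemClass.coe_mul, mul_assoc, ← mul_assoc (X j f₁ : SeqAlg A),
        ← (mem_relCommutant A).1 (X j f₁).2]
      simp only [mul_assoc]
    have hφf : φ j f₁ * φ j f₂ = 0 := (hφ0 j f₁ f₂ hf).1
    have hle : ‖kappaSeq A (X j f₁ * X j f₂)‖ ≤ 2 * M * δ := by
      -- `P f₁` and `P f₂` need not be orthogonal; the product is compared with `φ j f₁ * φ j f₂ =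
      -- 0`.
      have hdec : kappaSeq A (X j f₁ * X j f₂)
          = - (φ j (f₁ - P f₁) * φ j (P f₂)) - φ j f₁ * φ j (f₂ - P f₂) := by
        rw [map_mul, hXφ, hXφ, map_sub, map_sub, sub_mul, mul_sub, hφf]; abel
      rw [hdec]
      calc _ ≤ ‖φ j (f₁ - P f₁)‖ * ‖φ j (P f₂)‖ + ‖φ j f₁‖ * ‖φ j (f₂ - P f₂)‖ :=
            (norm_sub_le _ _).trans (by rw [norm_neg]; gcongr <;> exact norm_mul_le _ _)
        _ ≤ δ * M + M * δ := by
          gcongr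
          · exact (hφn j _).trans (hP' f₁ h₁)
          · exact (hφn j _).trans (hPn f₂ h₂)
          · exact (hφn j _).trans (by linarith [hMK f₁ h₁])
          · exact (hφn j _).trans (hP' f₂ h₂)
        _ = 2 * M * δ := by ring
    rw [heq]
    refine (hmul _ _ _ hle).trans_lt ?_
    have : ‖(star e * e) * (star e * e)‖ ≤ 1 :=
      (norm_mul_le _ _).trans (mul_le_one₀ he1.le (norm_nonneg _) he1.le)
    exact (mul_le_of_le_one_left (by positivity) this).trans_lt hδε
  have ev3 : ∀ᶠ n in atTop, ∀ a ∈ F, ∀ f ∈ K, ∀ j, ‖W j f n * a - a * W j f n‖ < ε := by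
    refine (eventually_all_finset _).2 fun a ha => (eventually_all_finset _).2 fun f hf => ?_
    refine eventually_all.2 fun j => ?_
    refine eventually_norm_lt_of_norm_etaSeq_lt (a := W j f * constSeq A a - constSeq A a * W j f) ?_
    have heq : etaSeq A (W j f * constSeq A a - constSeq A a * W j f)
        = seqIncl A (star e * e * a - a * (star e * e)) * (X j f : SeqAlg A) := by
      rw [map_sub, map_mul, map_mul, hW]
      change _ * seqIncl A a - seqIncl A a * _ = _
      generalize star e * e = b
      rw [mul_assoc, ← (mem_relCommutant A).1 (X j f).2 a, map_sub, sub_mul, map_mul, map_mul]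
      simp only [mul_assoc]
    rw [heq]
    refine (hmul _ _ M ?_).trans_lt ?_
    · rw [hXφ]; exact (hφn j _).trans (hPn f hf)
    · have : ‖star e * e * a - a * (star e * e)‖ ≤ 2 * δ := by
        have := norm_sub_le (star e * e * a - a) (a * (star e * e) - a)
        rw [sub_sub_sub_cancel_right] at this
        linarith [(heF a ha).1, (heF a ha).2]
      calc _ ≤ 2 * δ * M := by gcongr
        _ < ε := by linarith
  have ev4 : ∀ᶠ n in atTop, ∀ f ∈ K, ∀ j, ∀ s, ‖α s (W j f n) - W j (leftTranslate s f) n‖ < ε := by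
    refine (eventually_all_finset _).2 fun f hf => eventually_all.2 fun j => ?_
    refine eventually_forall_norm_lt
      (f := fun s => bddSeqMap (α s) (W j f) - W j (leftTranslate s f)) ?_ fun s => ?_
    -- Membership of the towers in `F_α(A)` and invariance of `e` enter here, giving the continuity
    -- in `s` that allows one `n` for all of `G`.
    · refine Continuous.sub (cutSeq_mem_bddSeqCont (hcα j) heα _) (continuous_cutSeq _ _ fun i => ?_)
      exact f.continuous.comp (by fun_prop)
    · have heq : etaSeq A (bddSeqMap (α s) (W j f) - W j (leftTranslate s f))
          = seqIncl A (star e * e) * ((relCommutantMap (α s) (X j f) - X j (leftTranslate s f) :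
            relCommutant A) : SeqAlg A) := by
        rw [map_sub, hW, AddSubgroupClass.coe_sub, mul_sub]
        congr 1
        change seqAlgMap (α s) (etaSeq A (W j f)) = _
        rw [hW, map_mul, seqAlgMap_seqIncl, map_mul, map_star, heα]
        rfl
      rw [heq]
      refine (hmul _ _ (2 * δ) ?_).trans_lt ?_
      · rw [map_sub, hXφ, ← centralSeqMap_kappaSeq, hXφ]
        -- `P` does not commute with translations, but both `f` and its translate are within `δ` of
        -- their approximations.
        have hdec : centralSeqMap (α s) (φ j (P f)) - φ j (P (leftTranslate s f))
            = φ j (leftTranslate s f - P (leftTranslate s f))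
              - centralSeqMap (α s) (φ j (f - P f)) := by
          rw [map_sub (φ j), map_sub (φ j), map_sub (centralSeqMap _),
            hφe j s f]; abel
        rw [hdec]
        calc _ ≤ ‖φ j (leftTranslate s f - P (leftTranslate s f))‖
              + ‖centralSeqMap (α s) (φ j (f - P f))‖ := norm_sub_le _ _
          _ ≤ δ + δ := add_le_add ((hφn j _).trans (hP f hf s))
            ((NonUnitalStarAlgHom.norm_apply_le _ _).trans ((hφn j _).trans (hP' f hf)))
          _ = 2 * δ := by ring
      · calc _ ≤ 2 * δ := mul_le_of_le_one_left (by positivity) he1.le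
          _ < ε := by linarith
  have ev5 : ∀ᶠ n in atTop, ∀ a ∈ F, ‖(∑ j, W j 1 n) * a - a‖ < ε := by
    refine (eventually_all_finset _).2 fun a ha => ?_
    have hcoord : ∀ n, (∑ j, W j 1 n) * a - a = ((∑ j, W j 1) * constSeq A a - constSeq A a) n := by
      intro n
      rw [lp.coeFn_sub, Pi.sub_apply, lp.infty_coeFn_mul, Pi.mul_apply, lp.coeFn_sum,
        Finset.sum_apply]
      rfl
    simp only [hcoord]
    refine eventually_norm_lt_of_norm_etaSeq_lt ?_
    have hunit : ∀ y, kappaSeq A (∑ j, X j 1) * y = y := fun y => by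
      rw [map_sum]; simp only [hXφ, hP1]; exact (hφ1 y).1
    have heq : etaSeq A ((∑ j, W j 1) * constSeq A a - constSeq A a)
        = seqIncl A (star e * e * a - a) := by
      have h1 := seqIncl_mul_of_kappaSeq_isUnit hunit a
      rw [map_sub, map_mul, map_sum]
      simp only [hW]
      rw [← Finset.mul_sum, ← AddSubmonoidClass.coe_finsetSum]
      change _ * _ * seqIncl A a - seqIncl A a = _
      rw [mul_assoc, ← (mem_relCommutant A).1 (∑ j, X j 1).2 a, h1, map_sub, map_mul _ _ a]
    rw [heq]
    exact (norm_seqIncl_le _).trans_lt (by linarith [(heF a ha).1])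
  obtain ⟨n, h1, h2, h3, h4, h5⟩ := (ev1.and (ev2.and (ev3.and (ev4.and ev5)))).exists
  refine ⟨ψ n, fun j f => ?_, ?_, ?_, ?_, ?_⟩
  · have hone : ‖∑ i : T, star (c j i n * e) * (c j i n * e)‖ ≤ 1 := by
      have := h1 j
      rw [← hψW] at this
      have hψ1 : ψ n j 1 = ∑ i : T, star (c j i n * e) * (c j i n * e) :=
        Finset.sum_congr rfl fun i _ => one_smul ℂ _
      exact hψ1 ▸ this.le
    exact (norm_sum_smul_star_mul_self_le _ _ (norm_nonneg f) fun i => f.norm_coe_le_norm _).trans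
      (mul_le_of_le_one_right (norm_nonneg _) hone)
  · simpa only [hψW] using h2
  · simpa only [hψW] using h3
  · intro f hf s j
    simpa only [hψW] using h4 f hf j s
  · simpa only [hψW] using h5

end TowersToSystems

/-! ### Completely positive maps induced by sequences. -/

section SequencesOfCPMaps

variable {B A : Type*} [NonUnitalCStarAlgebra B] [NonUnitalCStarAlgebra A]

/-- A sequence of contractions as a linear map to `ℓ^∞(ℕ, A)`. -/
def boundedSeq (ψ : ℕ → (B →ₗ[ℂ] A)) (hψ : ∀ n b, ‖ψ n b‖ ≤ ‖b‖) : B →ₗ[ℂ] BddSeq A where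
  toFun b := ⟨fun n => ψ n b, memℓp_infty ⟨‖b‖, by rintro _ ⟨n, rfl⟩; exact hψ n b⟩⟩
  map_add' b c := by ext n; exact map_add (ψ n) b c
  map_smul' z b := by ext n; exact map_smul (ψ n) z b

theorem boundedSeq_apply (ψ : ℕ → (B →ₗ[ℂ] A)) (hψ : ∀ n b, ‖ψ n b‖ ≤ ‖b‖) (b : B) (n : ℕ) :
    boundedSeq ψ hψ b n = ψ n b := rfl

theorem norm_boundedSeq_le (ψ : ℕ → (B →ₗ[ℂ] A)) (hψ : ∀ n b, ‖ψ n b‖ ≤ ‖b‖) (b : B) :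
    ‖boundedSeq ψ hψ b‖ ≤ ‖b‖ :=
  lp.norm_le_of_forall_le (norm_nonneg b) fun n => hψ n b

theorem continuous_boundedSeq (ψ : ℕ → (B →ₗ[ℂ] A)) (hψ : ∀ n b, ‖ψ n b‖ ≤ ‖b‖) :
    Continuous (boundedSeq ψ hψ) :=
  AddMonoidHomClass.continuous_of_bound _ 1 fun b => by
    rw [one_mul]; exact norm_boundedSeq_le ψ hψ b

variable [PartialOrder B] [StarOrderedRing B] [PartialOrder A] [StarOrderedRing A]

theorem exists_star_mul_self_boundedSeq
    (ψ : ℕ → (B →CP A)) (hψ : ∀ n b, ‖ψ n b‖ ≤ ‖b‖) {k : ℕ} {M : CStarMatrix (Fin k) (Fin k) B}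
    (hM : 0 ≤ M) : ∃ Z : Fin k → Fin k → BddSeq A, ∀ i j,
      boundedSeq (fun n => (ψ n).toLinearMap) hψ (M i j) = ∑ l, star (Z l i) * Z l j := by
  have h : ∀ n, ∃ Z : CStarMatrix (Fin k) (Fin k) A, M.map (ψ n) = star Z * Z := fun n =>
    CStarMatrix.exists_eq_star_mul_self ((ψ n).map_cstarMatrix_nonneg M hM)
  choose Z hZ using h
  have hentry : ∀ n i j, ψ n (M i j) = ∑ l, star (Z n l i) * Z n l j := by
    intro n i j
    have := CStarMatrix.ext_iff.2 (hZ n) i j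
    rw [CStarMatrix.mul_apply] at this
    simp only [CStarMatrix.star_apply] at this
    exact this
  -- The diagonal entry of `Z⋆Z` dominates each `star (Z n l j) * Z n l j`, so the coordinatewise
  -- factors form bounded sequences.
  have hbound : ∀ n l j, ‖Z n l j‖ ^ 2 ≤ ‖M j j‖ := by
    intro n l j
    refine le_trans ?_ (hψ n (M j j))
    rw [hentry, sq, ← CStarRing.norm_star_mul_self]
    exact CStarAlgebra.norm_le_norm_of_nonneg_of_le (star_mul_self_nonneg _)
      (Finset.single_le_sum (f := fun l => star (Z n l j) * Z n l j)
        (fun l _ => star_mul_self_nonneg _) (Finset.mem_univ l))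
  refine ⟨fun l j => ⟨fun n => Z n l j, memℓp_infty ⟨Real.sqrt ‖M j j‖, ?_⟩⟩, fun i j => ?_⟩
  · rintro _ ⟨n, rfl⟩
    exact Real.le_sqrt_of_sq_le (hbound n l j)
  · ext n
    rw [boundedSeq_apply, lp.coeFn_sum, Finset.sum_apply]
    exact hentry n i j

/-- The c.p. map to `F(A)` induced by an asymptotically central sequence of c.c.p. maps. -/
def CompletelyPositiveMap.toCentralSeq
    (ψ : ℕ → (B →CP A)) (hψ : ∀ n b, ‖ψ n b‖ ≤ ‖b‖)
    (hc : ∀ b, etaSeq A (boundedSeq (fun n => (ψ n).toLinearMap) hψ b) ∈ relCommutant A) :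
    B →CP CentralSeqAlg A where
  toFun b := kappaSeq A ⟨_, hc b⟩
  map_add' b c := by
    rw [← map_add]; congr 1; ext1
    simp only [map_add]; rfl
  map_smul' z b := by
    rw [RingHom.id_apply, ← map_smul]; congr 1; ext1
    simp only [map_smul]; rfl
  map_cstarMatrix_nonneg' k M hM := by
    let _ : PartialOrder (relCommutant A) := CStarAlgebra.spectralOrder _
    have _ : StarOrderedRing (relCommutant A) := CStarAlgebra.spectralOrderedRing _
    obtain ⟨Z, hZ⟩ := exists_star_mul_self_boundedSeq ψ hψ hM
    let Y : CStarMatrix (Fin k) (Fin k) (SeqAlg A) :=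
      CStarMatrix.ofMatrix fun l j => etaSeq A (Z l j)
    let N : CStarMatrix (Fin k) (Fin k) (relCommutant A) := M.map fun b => ⟨_, hc b⟩
    -- The factor `Y` need not have entries in the commutant, so positivity is seen over `A_∞` and
    -- pulled back along the injective inclusion.
    have hN : 0 ≤ N := by
      refine nonneg_of_map_nonneg (CStarMatrix.mapₙₐ
        (NonUnitalStarSubalgebraClass.subtype (relCommutant A))) ?_ ?_
      · exact CStarMatrix.map_injective Subtype.val_injective
      · have : CStarMatrix.mapₙₐ (NonUnitalStarSubalgebraClass.subtype (relCommutant A)) N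
            = star Y * Y := by
          ext i j
          rw [CStarMatrix.mul_apply]
          change etaSeq A (boundedSeq _ hψ (M i j)) = _
          rw [hZ, map_sum]
          refine Finset.sum_congr rfl fun l _ => ?_
          rw [CStarMatrix.star_apply, map_mul, map_star]
          rfl
        rw [this]
        exact star_mul_self_nonneg _
    exact CompletelyPositiveMapClass.map_cstarMatrix_nonneg' (kappaSeq A) k N hN

end SequencesOfCPMaps

/-! ### From Rokhlin systems to Rokhlin towers. -/

section SystemsToTowers

theorem Set.Countable.exists_seq_finset {X : Type*} {S : Set X} (hS : S.Countable) :
    ∃ F : ℕ → Finset X, (∀ n, (F n : Set X) ⊆ S) ∧ ∀ s ∈ S, ∀ᶠ n in atTop, s ∈ F n := by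
  classical
  rcases S.eq_empty_or_nonempty with rfl | hne
  · exact ⟨fun _ => ∅, by simp, by simp⟩
  obtain ⟨u, rfl⟩ := hS.exists_eq_range hne
  refine ⟨fun n => (Finset.range n).image u, fun n => by
    rw [Finset.coe_image]; exact Set.image_subset_range _ _, ?_⟩
  rintro _ ⟨k, rfl⟩
  filter_upwards [eventually_gt_atTop k] with n hn
  exact Finset.mem_image_of_mem _ (Finset.mem_range.2 hn)

/-- A countable dense set in which every orthogonal pair can be approximated by orthogonal pairs. -/
theorem exists_countable_dense_orthogonal (B : Type*) [NonUnitalCStarAlgebra B]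
    [TopologicalSpace.SeparableSpace B] :
    ∃ D : Set B, D.Countable ∧ Dense D ∧
      {p : B × B | COrthogonal p.1 p.2} ⊆
        closure {p : B × B | COrthogonal p.1 p.2 ∧ p.1 ∈ D ∧ p.2 ∈ D} := by
  have : SecondCountableTopology B := UniformSpace.secondCountable_of_separable B
  -- A dense set may contain few orthogonal pairs. The set of these pairs is itself separable, and
  -- the coordinates of a countable dense part of it are adjoined.
  obtain ⟨Q, hQ, hQc, hQd⟩ := (TopologicalSpace.IsSeparable.of_separableSpace
    {p : B × B | COrthogonal p.1 p.2}).exists_countable_dense_subset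
  obtain ⟨D, hDc, hD⟩ := TopologicalSpace.exists_countable_dense B
  refine ⟨D ∪ (Prod.fst '' Q ∪ Prod.snd '' Q), hDc.union ((hQc.image _).union (hQc.image _)),
    hD.mono Set.subset_union_left, hQd.trans (closure_mono fun p hp => ⟨hQ hp, ?_, ?_⟩)⟩
  · exact Or.inr (Or.inl ⟨p, hp, rfl⟩)
  · exact Or.inr (Or.inr ⟨p, hp, rfl⟩)

theorem COrthogonal.symm {B : Type*} [NonUnitalCStarAlgebra B] {a b : B} (h : COrthogonal a b) :
    COrthogonal b a := ⟨h.2.1, h.1, h.2.2.2, h.2.2.1⟩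

theorem continuous_leftTranslate {G : Type*} [Group G] [TopologicalSpace G] [IsTopologicalGroup G]
    (s : G) : Continuous (leftTranslate s : C(G, ℂ) → C(G, ℂ)) :=
  ContinuousMap.continuous_precomp ⟨fun t => s⁻¹ * t, by fun_prop⟩

theorem continuous_leftTranslate_left {G : Type*} [Group G] [TopologicalSpace G]
    [IsTopologicalGroup G] (f : C(G, ℂ)) : Continuous fun s => leftTranslate s f := by
  refine ContinuousMap.continuous_of_continuous_uncurry _ ?_
  exact f.continuous.comp (by fun_prop : Continuous fun p : G × G => p.1⁻¹ * p.2)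

theorem COrthogonal.star_left {G : Type*} [TopologicalSpace G] [CompactSpace G] {f g : C(G, ℂ)}
    (h : COrthogonal f g) : COrthogonal (star f) g :=
  ⟨h.2.2.1, by rw [mul_comm]; exact h.2.2.1, by rw [star_star]; exact h.1, by
    rw [← star_mul, h.1, star_zero]⟩

variable {A : Type*} [NonUnitalCStarAlgebra A]

/-- As `S = S⋆`, the generators also commute with `x⋆`; the elements of `A` commuting with both `x`
and `x⋆` form a closed ⋆-subalgebra. -/
theorem mem_relCommutant_of_generators {S : Set A}
    (hS_star : star S = S) (hS_gen : (NonUnitalStarAlgebra.adjoin ℂ S).topologicalClosure = ⊤)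
    {x : SeqAlg A} (hx : ∀ a ∈ S, seqIncl A a * x = x * seqIncl A a) :
    x ∈ relCommutant A := by
  let N : NonUnitalStarSubalgebra ℂ A :=
    (NonUnitalStarSubalgebra.centralizer ℂ {x}).comap (seqIncl A)
  have hN : IsClosed (N : Set A) :=
    (Set.isClosed_centralizer _).preimage (NonUnitalStarAlgHom.continuous_of_cstar (seqIncl A))
  have hSN : S ⊆ N := by
    intro a ha
    have hsa : star a ∈ S := by rw [← hS_star]; simpa using ha
    change seqIncl A a ∈ NonUnitalStarSubalgebra.centralizer ℂ {x}
    rw [NonUnitalStarSubalgebra.mem_centralizer_iff]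
    rintro _ rfl
    refine ⟨(hx a ha).symm, ?_⟩
    have := congrArg star (hx _ hsa)
    rw [star_mul, star_mul, ← map_star, star_star] at this
    exact this
  have htop : (⊤ : NonUnitalStarSubalgebra ℂ A) ≤ N := hS_gen ▸
    NonUnitalStarSubalgebra.topologicalClosure_minimal _ (NonUnitalStarAlgebra.adjoin_le hSN) hN
  rw [mem_relCommutant]
  intro a
  have := (NonUnitalStarSubalgebra.mem_centralizer_iff ℂ).1
    (show seqIncl A a ∈ NonUnitalStarSubalgebra.centralizer ℂ {x} from htop trivial) x rfl
  exact this.1.symm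

theorem seqIncl_mul_eq_of_generators {S : Set A}
    (hS_star : star S = S) (hS_gen : (NonUnitalStarAlgebra.adjoin ℂ S).topologicalClosure = ⊤)
    {x : SeqAlg A} (hx : ∀ a ∈ S, x * seqIncl A a = seqIncl A a) (a : A) :
    x * seqIncl A a = seqIncl A a := by
  -- The left identity `x a = a` alone is not visibly stable under the involution, so it is imposed
  -- on `a` and `star a` together.
  let N : NonUnitalStarSubalgebra ℂ A :=
    { carrier := {a | x * seqIncl A a = seqIncl A a ∧
        x * seqIncl A (star a) = seqIncl A (star a)}
      add_mem' := fun ha hb => by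
        simp only [Set.mem_ofPred_eq, star_add, map_add, mul_add] at ha hb ⊢
        rw [ha.1, ha.2, hb.1, hb.2]; exact ⟨rfl, rfl⟩
      zero_mem' := by simp
      smul_mem' := fun c a ha => by
        simp only [Set.mem_ofPred_eq, star_smul, map_smul, mul_smul_comm] at ha ⊢
        rw [ha.1, ha.2]; exact ⟨rfl, rfl⟩
      mul_mem' := fun ha hb => by
        simp only [Set.mem_ofPred_eq, star_mul, map_mul, ← mul_assoc] at ha hb ⊢
        rw [ha.1, hb.2]; exact ⟨rfl, rfl⟩
      star_mem' := fun ha => by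
        simp only [Set.mem_ofPred_eq, star_star] at ha ⊢
        exact ha.symm }
  have hcont : Continuous (seqIncl A) := NonUnitalStarAlgHom.continuous_of_cstar _
  have hN : IsClosed (N : Set A) :=
    (isClosed_eq (by fun_prop) hcont).inter (isClosed_eq (by fun_prop) (by fun_prop))
  have hSN : S ⊆ N := fun a ha => ⟨hx a ha, hx _ (by rw [← hS_star]; simpa using ha)⟩
  have htop : (⊤ : NonUnitalStarSubalgebra ℂ A) ≤ N := hS_gen ▸
    NonUnitalStarSubalgebra.topologicalClosure_minimal _ (NonUnitalStarAlgebra.adjoin_le hSN) hN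
  exact (htop (trivial : a ∈ (⊤ : NonUnitalStarSubalgebra ℂ A))).1

/-- A sequence of approximately equivariant values is norm continuous. -/
theorem mem_bddSeqCont_of_tendsto {G : Type*} [Group G] [TopologicalSpace G]
    [IsTopologicalGroup G] [CompactSpace G] {α : G →* (A ≃⋆ₐ[ℂ] A)}
    (hα : ∀ a : A, Continuous fun g => α g a) {ψ : ℕ → (C(G, ℂ) →ₗ[ℂ] A)}
    (hψ : ∀ n f, ‖ψ n f‖ ≤ ‖f‖) {f : C(G, ℂ)}
    (hf : ∀ ε : ℝ, 0 < ε → ∀ᶠ n in atTop, ∀ s, ‖α s (ψ n f) - ψ n (leftTranslate s f)‖ < ε) :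
    boundedSeq ψ hψ f ∈ bddSeqCont α := by
  rw [mem_bddSeqCont, continuous_iff_continuousAt]
  intro g₀
  refine Metric.tendsto_nhds.2 fun ε hε => ?_
  -- From `N` on, approximate equivariance reduces continuity to that of translation in `C(G)`,
  -- uniformly in `n`; the finitely many earlier terms are continuous by `hα`. Three errors `ε / 4`
  -- leave room for a strict inequality.
  obtain ⟨N, hN⟩ := eventually_atTop.1 (hf (ε / 4) (by positivity))
  have h1 : ∀ᶠ g in 𝓝 g₀, ‖leftTranslate g f - leftTranslate g₀ f‖ < ε / 4 := by
    have := Metric.tendsto_nhds.1 ((continuous_leftTranslate_left f).tendsto g₀) (ε / 4)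
      (by positivity)
    simpa only [dist_eq_norm] using this
  have h2 : ∀ᶠ g in 𝓝 g₀, ∀ n ∈ Finset.range N, ‖α g (ψ n f) - α g₀ (ψ n f)‖ < 3 * (ε / 4) := by
    refine (eventually_all_finset _).2 fun n _ => ?_
    have := Metric.tendsto_nhds.1 ((hα (ψ n f)).tendsto g₀) (3 * (ε / 4)) (by positivity)
    simpa only [dist_eq_norm] using this
  filter_upwards [h1, h2] with g hg1 hg2
  rw [dist_eq_norm]
  refine (lp.norm_le_of_forall_le (C := 3 * (ε / 4)) (by positivity) fun n => ?_).trans_lt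
    (by linarith)
  change ‖α g (ψ n f) - α g₀ (ψ n f)‖ ≤ _
  rcases lt_or_ge n N with hn | hn
  · exact (hg2 n (Finset.mem_range.2 hn)).le
  · have hdec : α g (ψ n f) - α g₀ (ψ n f) = (α g (ψ n f) - ψ n (leftTranslate g f))
        + ψ n (leftTranslate g f - leftTranslate g₀ f)
        - (α g₀ (ψ n f) - ψ n (leftTranslate g₀ f)) := by
      rw [map_sub]; abel
    rw [hdec]
    have e1 := (hN n hn g).le
    have e2 := (hN n hn g₀).le
    have e3 := (hψ n (leftTranslate g f - leftTranslate g₀ f)).trans hg1.le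
    calc _ ≤ ‖α g (ψ n f) - ψ n (leftTranslate g f)‖
          + ‖ψ n (leftTranslate g f - leftTranslate g₀ f)‖
          + ‖α g₀ (ψ n f) - ψ n (leftTranslate g₀ f)‖ :=
            (norm_sub_le _ _).trans (by gcongr; exact norm_add_le _ _)
      _ ≤ ε / 4 + ε / 4 + ε / 4 := by gcongr
      _ = 3 * (ε / 4) := by ring

end SystemsToTowers

section SystemsToTowers

variable {G A : Type*} [Group G] [TopologicalSpace G] [IsTopologicalGroup G] [CompactSpace G]
  [NonUnitalCStarAlgebra A]

theorem hasRokhlinTowers_of_isRokhlinSystem [T2Space G] [SecondCountableTopology G]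
    [PartialOrder A] [StarOrderedRing A] {S : Set A} (hS_countable : S.Countable)
    (hS_star : star S = S) (hS_gen : (NonUnitalStarAlgebra.adjoin ℂ S).topologicalClosure = ⊤)
    {α : G →* (A ≃⋆ₐ[ℂ] A)} (hα : ∀ a : A, Continuous fun g => α g a) {d : ℕ}
    (h : ∀ F : Finset A, (F : Set A) ⊆ S → ∀ (K : Finset C(G, ℂ)) (ε : ℝ), 0 < ε →
      ∃ ψ : Fin (d + 1) → (C(G, ℂ) →CP A), IsRokhlinSystem α d F K ε ψ) :
    HasRokhlinTowers α d := by
  obtain ⟨D, hDc, hDd, hDo⟩ := exists_countable_dense_orthogonal C(G, ℂ)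
  obtain ⟨F, hFS, hF⟩ := hS_countable.exists_seq_finset
  obtain ⟨K, -, hK⟩ := hDc.exists_seq_finset
  choose ψ hψ using fun n : ℕ => h (F n) (hFS n) (K n) (1 / (n + 1 : ℝ)) (by positivity)
  have hsmall : ∀ ε : ℝ, 0 < ε → ∀ᶠ n : ℕ in atTop, 1 / (n + 1 : ℝ) < ε := fun ε hε =>
    (tendsto_one_div_add_atTop_nhds_zero_nat (𝕜 := ℝ)).eventually (gt_mem_nhds hε)
  have hψn : ∀ j n f, ‖ψ n j f‖ ≤ ‖f‖ := fun j n f => (hψ n).contractive j f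
  let Θ : Fin (d + 1) → C(G, ℂ) →ₗ[ℂ] BddSeq A := fun j =>
    boundedSeq (fun n => (ψ n j).toLinearMap) (hψn j)
  have hΘc : ∀ j, Continuous (Θ j) := fun j => continuous_boundedSeq _ (hψn j)
  have hηc : Continuous (etaSeq A) := NonUnitalStarAlgHom.continuous_of_cstar _
  have hηΘc : ∀ j, Continuous fun f => etaSeq A (Θ j f) := fun j => hηc.comp (hΘc j)
  have hzero : ∀ b : BddSeq A, (∀ᶠ n : ℕ in atTop, ‖b n‖ < 1 / (n + 1 : ℝ)) → etaSeq A b = 0 :=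
    fun b hb => etaSeq_eq_zero_iff.2 <| squeeze_zero_norm' (hb.mono fun n hn => hn.le)
      tendsto_one_div_add_atTop_nhds_zero_nat
  have hcomm : ∀ j f, etaSeq A (Θ j f) ∈ relCommutant A := by
    refine fun j f => mem_relCommutant_of_generators hS_star hS_gen fun a ha => ?_
    refine hDd.induction (P := fun f => seqIncl A a * etaSeq A (Θ j f)
      = etaSeq A (Θ j f) * seqIncl A a) (fun f hf => ?_) (isClosed_eq ?_ ?_) f
    · refine (sub_eq_zero.1 ?_).symm
      change _ * etaSeq A (constSeq A a) - etaSeq A (constSeq A a) * _ = 0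
      rw [← map_mul, ← map_mul, ← map_sub]
      refine hzero _ ?_
      filter_upwards [hF a ha, hK f hf] with n hn1 hn2
      exact (hψ n).commute a hn1 f hn2 j
    · exact continuous_const.mul (hηΘc j)
    · exact (hηΘc j).mul continuous_const
  have hequiv : ∀ j s f, seqAlgMap (α s) (etaSeq A (Θ j f)) = etaSeq A (Θ j (leftTranslate s f)) := by
    intro j s f
    have hc : Continuous (seqAlgMap (α s)) := NonUnitalStarAlgHom.continuous_of_cstar _
    refine hDd.induction (P := fun f => seqAlgMap (α s) (etaSeq A (Θ j f))
      = etaSeq A (Θ j (leftTranslate s f))) (fun f hf => ?_) (isClosed_eq ?_ ?_) f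
    · refine sub_eq_zero.1 ?_
      change etaSeq A (bddSeqMap (α s) (Θ j f)) - _ = 0
      rw [← map_sub]
      refine hzero _ ?_
      filter_upwards [hK f hf] with n hn
      exact (hψ n).equivariant f hn s j
    · exact hc.comp (hηΘc j)
    · exact (hηΘc j).comp (continuous_leftTranslate s)
  have hcont : ∀ j f, Θ j f ∈ bddSeqCont α := by
    intro j f
    refine hDd.induction (P := fun f => Θ j f ∈ bddSeqCont α) (fun f hf => ?_)
      ((isClosed_bddSeqCont α).preimage (hΘc j)) f
    refine mem_bddSeqCont_of_tendsto hα (hψn j) fun ε hε => ?_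
    filter_upwards [hK f hf, hsmall ε hε] with n hn1 hn2 s
    exact ((hψ n).equivariant f hn1 s j).trans hn2
  have horth : ∀ j f₁ f₂, COrthogonal f₁ f₂ → etaSeq A (Θ j f₁) * etaSeq A (Θ j f₂) = 0 := by
    intro j f₁ f₂ hf
    have hclosed : IsClosed {p : C(G, ℂ) × C(G, ℂ) |
        etaSeq A (Θ j p.1) * etaSeq A (Θ j p.2) = 0} :=
      isClosed_eq (((hηΘc j).comp continuous_fst).mul ((hηΘc j).comp continuous_snd))
        continuous_const
    -- Vanishing of the product is closed in the pair, so it passes from orthogonal pairs in `D` to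
    -- all orthogonal pairs.
    refine closure_minimal ?_ hclosed (hDo (show (f₁, f₂) ∈ {p : C(G, ℂ) × C(G, ℂ) |
      COrthogonal p.1 p.2} from hf))
    rintro ⟨g₁, g₂⟩ ⟨hg, hg₁, hg₂⟩
    change etaSeq A (Θ j g₁) * etaSeq A (Θ j g₂) = 0
    rw [← map_mul]
    refine hzero _ ?_
    filter_upwards [hK g₁ hg₁, hK g₂ hg₂] with n hn1 hn2
    exact (hψ n).orderZero g₁ hn1 g₂ hn2 hg j
  have hunit : ∀ a, (∑ j, etaSeq A (Θ j 1)) * seqIncl A a = seqIncl A a := by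
    refine seqIncl_mul_eq_of_generators hS_star hS_gen fun a ha => sub_eq_zero.1 ?_
    change _ * etaSeq A (constSeq A a) - etaSeq A (constSeq A a) = 0
    rw [← map_sum, ← map_mul, ← map_sub]
    refine hzero _ ?_
    filter_upwards [hF a ha] with n hn
    have := (hψ n).unit a hn
    rw [lp.coeFn_sub, Pi.sub_apply, lp.infty_coeFn_mul, Pi.mul_apply, lp.coeFn_sum,
      Finset.sum_apply]
    exact this
  let φ : Fin (d + 1) → (C(G, ℂ) →CP CentralSeqAlg A) := fun j =>
    CompletelyPositiveMap.toCentralSeq (fun n => ψ n j) (hψn j) (hcomm j)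
  have hφ : ∀ j f, φ j f = kappaSeq A ⟨etaSeq A (Θ j f), hcomm j f⟩ := fun _ _ => rfl
  have hφmul : ∀ j f₁ f₂, COrthogonal f₁ f₂ → φ j f₁ * φ j f₂ = 0 := by
    intro j f₁ f₂ hf
    rw [hφ, hφ, ← map_mul, ← map_zero (kappaSeq A)]
    congr 1
    exact Subtype.ext (horth j f₁ f₂ hf)
  -- Positive maps preserve adjoints and `C(G)` is commutative, so the remaining orthogonality
  -- relations follow from vanishing products.
  have hφstar : ∀ j f, star (φ j f) = φ j (star f) := fun j f => (map_star (φ j) f).symm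
  refine ⟨φ, fun j f => ?_, fun j f => ?_, fun j f₁ f₂ hf => ⟨?_, ?_, ?_, ?_⟩, fun j s f => ?_, ?_⟩
  · exact ⟨⟨etaSeq A (Θ j f), hcomm j f⟩, ⟨Θ j f, hcont j f, rfl⟩, rfl⟩
  · exact (NonUnitalStarAlgHom.norm_apply_le (kappaSeq A) _).trans
      ((NonUnitalStarAlgHom.norm_apply_le (etaSeq A) _).trans (norm_boundedSeq_le _ (hψn j) f))
  · exact hφmul j f₁ f₂ hf
  · exact hφmul j f₂ f₁ hf.symm
  · rw [hφstar]; exact hφmul j _ _ hf.star_left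
  · rw [hφstar]; exact hφmul j _ _ hf.symm.star_left
  · rw [hφ, hφ, centralSeqMap_kappaSeq]
    congr 1
    exact Subtype.ext (hequiv j s f)
  · let U : relCommutant A := ∑ j, ⟨etaSeq A (Θ j 1), hcomm j 1⟩
    have hU : ∑ j, φ j 1 = kappaSeq A U := by simp only [hφ, U, map_sum]
    have hUa : ∀ a, seqIncl A a * (U : SeqAlg A) = seqIncl A a := by
      intro a
      rw [(mem_relCommutant A).1 U.2 a, AddSubmonoidClass.coe_finsetSum]
      exact hunit a
    intro x
    obtain ⟨y, rfl⟩ := kappaSeq_surjective x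
    rw [hU, ← map_mul, ← map_mul, kappaSeq_eq_iff, kappaSeq_eq_iff]
    refine ⟨fun a => ?_, fun a => ?_⟩
    · rw [MulMemClass.coe_mul, ← mul_assoc, hUa]
    · rw [MulMemClass.coe_mul, ← mul_assoc, (mem_relCommutant A).1 y.2 a, mul_assoc, hUa]

end SystemsToTowers

/-! ### Rokhlin dimension as a threshold. -/

section Monotonicity

variable {G A : Type*} [Group G] [TopologicalSpace G] [IsTopologicalGroup G] [CompactSpace G]
  [NonUnitalCStarAlgebra A]

/-- The zero map is completely positive. -/
def CompletelyPositiveMap.zeroMap (B C : Type*) [NonUnitalCStarAlgebra B] [PartialOrder B]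
    [StarOrderedRing B] [NonUnitalCStarAlgebra C] [PartialOrder C] [StarOrderedRing C] :
    B →CP C where
  toLinearMap := 0
  map_cstarMatrix_nonneg' _ _ _ := le_of_eq rfl

/-- Padding with zero maps changes neither the sum nor the other conditions. Hence a bound on the
infimum `rokhlinDim` yields towers at that very level. -/
theorem HasRokhlinTowers.mono {α : G →* (A ≃⋆ₐ[ℂ] A)} {d d' : ℕ} (hd : d ≤ d')
    (h : HasRokhlinTowers α d) : HasRokhlinTowers α d' := by
  obtain ⟨k, rfl⟩ := Nat.exists_eq_add_of_le hd
  obtain ⟨φ, hφα, hφn, hφ0, hφe, hφ1⟩ := h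
  let z : C(G, ℂ) →CP CentralSeqAlg A := CompletelyPositiveMap.zeroMap _ _
  have hz : ∀ f, z f = 0 := fun _ => rfl
  let Φ : Fin (d + k + 1) → (C(G, ℂ) →CP CentralSeqAlg A) := fun j =>
    if hj : (j : ℕ) < d + 1 then φ ⟨j, hj⟩ else z
  have hΦ : ∀ (P : (C(G, ℂ) →CP CentralSeqAlg A) → Prop), (∀ j, P (φ j)) → P z → ∀ j, P (Φ j) := by
    intro P h1 h2 j
    by_cases hj : (j : ℕ) < d + 1
    · simpa only [Φ, dif_pos hj] using h1 _
    · simpa only [Φ, dif_neg hj] using h2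
  have hsum : ∑ j, Φ j 1 = ∑ j, φ j 1 := by
    have h1 : ∑ j, Φ j 1 = ∑ i ∈ Finset.range (d + k + 1),
        (if hj : i < d + 1 then φ ⟨i, hj⟩ 1 else 0) := by
      rw [Finset.sum_range]
      refine Finset.sum_congr rfl fun j _ => ?_
      by_cases hj : (j : ℕ) < d + 1
      · simp only [Φ, dif_pos hj]
      · simp only [Φ, dif_neg hj, hz]
    have h2 : ∑ j, φ j 1 = ∑ i ∈ Finset.range (d + 1),
        (if hj : i < d + 1 then φ ⟨i, hj⟩ 1 else 0) := by
      rw [Finset.sum_range]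
      exact Finset.sum_congr rfl fun j _ => by rw [dif_pos j.2]
    rw [h1, h2]
    refine (Finset.sum_subset (Finset.range_mono (by omega)) fun i _ hi => ?_).symm
    rw [dif_neg (by simpa using hi)]
  refine ⟨Φ, ?_, ?_, ?_, ?_, ?_⟩
  · exact hΦ (fun ψ => ∀ f, ψ f ∈ centralSeqCont α) hφα fun f => by rw [hz]; exact zero_mem _
  · exact hΦ (fun ψ => ∀ f, ‖ψ f‖ ≤ ‖f‖) hφn fun f => by rw [hz, norm_zero]; exact norm_nonneg f
  · refine hΦ (fun ψ => ∀ f₁ f₂, COrthogonal f₁ f₂ → COrthogonal (ψ f₁) (ψ f₂)) hφ0 ?_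
    intro f₁ f₂ _
    simp [hz, COrthogonal]
  · refine hΦ (fun ψ => ∀ s f, centralSeqMap (α s) (ψ f) = ψ (leftTranslate s f)) hφe ?_
    intro s f
    rw [hz, hz, map_zero]
  · rwa [hsum]

theorem rokhlinDim_le_iff {α : G →* (A ≃⋆ₐ[ℂ] A)} {d : ℕ} :
    rokhlinDim α ≤ d ↔ HasRokhlinTowers α d := by
  refine ⟨fun h => ?_, fun h => iInf₂_le d h⟩
  by_contra hd
  have hlt : ∀ d', HasRokhlinTowers α d' → ((d + 1 : ℕ) : ℕ∞) ≤ d' := fun d' hd' => by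
    by_contra hlt
    exact hd (hd'.mono (by have := not_le.1 hlt; norm_cast at this; omega))
  have h1 : ((d + 1 : ℕ) : ℕ∞) ≤ d := (le_iInf₂ hlt).trans h
  norm_cast at h1
  omega

end Monotonicity
end

theorem mainTheorem4 {G : Type*} [Group G] [TopologicalSpace G] [IsTopologicalGroup G]
    [CompactSpace G] [T2Space G] [SecondCountableTopology G]
    {A : Type*} [NonUnitalCStarAlgebra A] [PartialOrder A] [StarOrderedRing A]
    [TopologicalSpace.SeparableSpace A]
    (S : Set A) (hS_countable : S.Countable) (hS_star : star S = S)
    (hS_gen : (NonUnitalStarAlgebra.adjoin ℂ S).topologicalClosure = ⊤)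
    (α : G →* (A ≃⋆ₐ[ℂ] A)) (hα : ∀ a : A, Continuous fun g => α g a) (d : ℕ) :
    rokhlinDim α ≤ d ↔
      ∀ F : Finset A, (F : Set A) ⊆ S → ∀ (K : Finset C(G, ℂ)) (ε : ℝ), 0 < ε →
        ∃ ψ : Fin (d + 1) → (C(G, ℂ) →CP A), IsRokhlinSystem α d F K ε ψ := by
  rw [rokhlinDim_le_iff]
  exact ⟨fun h F _ K ε hε => h.exists_isRokhlinSystem hα F K hε,
    hasRokhlinTowers_of_isRokhlinSystem hS_countable hS_star hS_gen hα⟩
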